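/- Let $0<b<1$ with $b^2\notin\mathbb Q$ and $q=e^{\pi i b^2}$. Let $U_q(\mathfrak{sl}(2,\mathbb R))$ be the complex $*$-algebra generated by $\mathbf e,\mathbf f,\mathbf K^{\pm1}$ with $$\mathbf K\mathbf e=q^2\mathbf e\mathbf K,\qquad \mathbf K\mathbf f=q^{-2}\mathbf f\mathbf K,\qquad [\mathbf e,\mathbf f]=(q-q^{-1})(\mathbf K^{-1}-\mathbf K),\qquad \mathbf e^*=\mathbf e,\ \mathbf f^*=\mathbf f,\ \mathbf K^*=\mathbf K,$$ and Casimir element $\mathbf C=\mathbf e\mathbf f-q^{-1}\mathbf K-q\mathbf K^{-1}$. On $L^2(\mathbb R,du)$ let $u$ be multiplication by the coordinate and $p=\frac1{2\pi i}\frac{d}{du}$; a real linear combination $\alpha u+\beta p$ denotes the self-adjoint operator extending its action on Schwartz functions, and exponentials are taken in the functional calculus. Let $\mathcal W\subset L^2(\mathbb R)$ be the span of the functions $e^{-au^2+cu}P(u)$ with $a>0$, $c\in\mathbb C$, $P$ a polynomial. **Theorem.** The operators $$e=e^{2\pi b(u+p)}+e^{2\pi b(-u+p)},\qquad f=e^{-2\pi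 bp},\qquad K=e^{2\pi bu}$$ define an irreducible representation of $U_q(\mathfrak{sl}(2,\mathbb R))$ by positive operators on $L^2(\mathbb R)$, on which the Casimir acts by zero. In detail: 1. $e,f,K$ are positive self-adjoint operators with trivial kernel; here the sum in $e$ is the form sum (the self-adjoint operator associated with the sum of the two closed quadratic forms), and it extends the operator sum on the intersection of the domains of the two summands. 2. The dense subspace $\mathcal W$ is a core of each of $e^{2\pi b(u+p)}$, $e^{2\pi b(-u+p)}$, $f$ and $K$. 3. There is a representation $\pi$ of $U_q(\mathfrak{sl}(2,\mathbb R))$ on $\mathcal W$ in which $\mathbf e,\mathbf f,\mathbf K$ act as the restrictions of $e^{2\pi b(u+p)}+e^{2\pi b(-u+p)}$, $f$, $K$, and $\langle\pi(x)v,w\rangle=\langle v,\pi(x^*)w\rangle$ for all $x\in U_q(\mathfrak{sl}(2,\mathbb R))$ and $v,w\in\mathcal W$. 4. $\pi(\mathbf C)=0$. 5. Every bounded operator on $L^2(\mathbb R)$ that commutes with the unitary operators $e^{it},f^{it},K^{it}$ (powers of the operators $e$, $f$, $K$) for all $t\in\mathbb R$ is a multiple of the identity. -/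

import Mathlib

open MeasureTheory
open scoped SchwartzMap ComplexInnerProductSpace

namespace QuantumSL2

/-! ## The quantum group `U_q(sl(2,ℝ))`, `q = exp (π i b²)` -/

/-- The parameter `q = exp (π i b²)`. -/
noncomputable def qParam (b : ℝ) : ℂ := Complex.exp (Real.pi * Complex.I * (b : ℂ) ^ 2)

lemma qParam_ne_zero (b : ℝ) : qParam b ≠ 0 := Complex.exp_ne_zero _

lemma conj_qParam (b : ℝ) : starRingEnd ℂ (qParam b) = (qParam b)⁻¹ := by
  rw [qParam, ← Complex.exp_conj, ← Complex.exp_neg]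
  congr 1
  simp

/-- Names of the generators: `e`, `f`, `K` and `K⁻¹`. -/
inductive Gen
  | e
  | f
  | K
  | Kinv

/-- The defining relations, for the rescaled generators
`e = (i / (q - q⁻¹))⁻¹ E` and `f = (i / (q - q⁻¹))⁻¹ F`. -/
inductive Rel (b : ℝ) : FreeAlgebra ℂ Gen → FreeAlgebra ℂ Gen → Prop
  | K_Kinv : Rel b (FreeAlgebra.ι ℂ Gen.K * FreeAlgebra.ι ℂ Gen.Kinv) 1
  | Kinv_K : Rel b (FreeAlgebra.ι ℂ Gen.Kinv * FreeAlgebra.ι ℂ Gen.K) 1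
  | K_e : Rel b (FreeAlgebra.ι ℂ Gen.K * FreeAlgebra.ι ℂ Gen.e)
      ((qParam b) ^ 2 • (FreeAlgebra.ι ℂ Gen.e * FreeAlgebra.ι ℂ Gen.K))
  | K_f : Rel b (FreeAlgebra.ι ℂ Gen.K * FreeAlgebra.ι ℂ Gen.f)
      (((qParam b) ^ 2)⁻¹ • (FreeAlgebra.ι ℂ Gen.f * FreeAlgebra.ι ℂ Gen.K))
  | e_f : Rel b
      (FreeAlgebra.ι ℂ Gen.e * FreeAlgebra.ι ℂ Gen.f
        - FreeAlgebra.ι ℂ Gen.f * FreeAlgebra.ι ℂ Gen.e)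
      ((qParam b - (qParam b)⁻¹) • (FreeAlgebra.ι ℂ Gen.Kinv - FreeAlgebra.ι ℂ Gen.K))

/-- The complex algebra `U_q(sl₂)` given by generators and relations. -/
abbrev Uq (b : ℝ) : Type := RingQuot (Rel b)

/-- The generators of `U_q(sl₂)`. -/
noncomputable def gen (b : ℝ) (g : Gen) : Uq b :=
  RingQuot.mkAlgHom ℂ (Rel b) (FreeAlgebra.ι ℂ g)

lemma gen_K_Kinv (b : ℝ) : gen b .K * gen b .Kinv = 1 := by
  simpa [gen] using RingQuot.mkAlgHom_rel ℂ (Rel.K_Kinv (b := b))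

lemma gen_Kinv_K (b : ℝ) : gen b .Kinv * gen b .K = 1 := by
  simpa [gen] using RingQuot.mkAlgHom_rel ℂ (Rel.Kinv_K (b := b))

lemma gen_K_e (b : ℝ) :
    gen b .K * gen b .e = (qParam b) ^ 2 • (gen b .e * gen b .K) := by
  simpa only [gen, map_mul, map_smul] using RingQuot.mkAlgHom_rel ℂ (Rel.K_e (b := b))

lemma gen_K_f (b : ℝ) :
    gen b .K * gen b .f = ((qParam b) ^ 2)⁻¹ • (gen b .f * gen b .K) := by
  simpa only [gen, map_mul, map_smul] using RingQuot.mkAlgHom_rel ℂ (Rel.K_f (b := b))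

lemma gen_e_f (b : ℝ) :
    gen b .e * gen b .f - gen b .f * gen b .e
      = (qParam b - (qParam b)⁻¹) • (gen b .Kinv - gen b .K) := by
  simpa only [gen, map_mul, map_sub, map_smul] using RingQuot.mkAlgHom_rel ℂ (Rel.e_f (b := b))

/-- The Casimir element `C = e f - q⁻¹ K - q K⁻¹`. -/
noncomputable def casimir (b : ℝ) : Uq b :=
  gen b .e * gen b .f - (qParam b)⁻¹ • gen b .K - qParam b • gen b .Kinv

/-- The opposite algebra of `U_q(sl₂)` with scalars acting through complex conjugation, so that
algebra homomorphisms into it are conjugate-linear anti-homomorphisms into `U_q(sl₂)`. -/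
noncomputable abbrev conjOppositeAlgebra (b : ℝ) : Algebra ℂ (Uq b)ᵐᵒᵖ :=
  ((algebraMap ℂ (Uq b)ᵐᵒᵖ).comp (starRingEnd ℂ)).toAlgebra' (by
    intro c x
    exact Algebra.commutes (starRingEnd ℂ c) x)

/-- The conjugate-linear anti-homomorphism on the free algebra that fixes the generators. -/
noncomputable def freeStar (b : ℝ) : FreeAlgebra ℂ Gen →+* (Uq b)ᵐᵒᵖ :=
  letI := conjOppositeAlgebra b
  (FreeAlgebra.lift ℂ (fun g => MulOpposite.op (gen b g)) :
    FreeAlgebra ℂ Gen →ₐ[ℂ] (Uq b)ᵐᵒᵖ).toRingHom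

lemma freeStar_ι (b : ℝ) (g : Gen) :
    freeStar b (FreeAlgebra.ι ℂ g) = MulOpposite.op (gen b g) :=
  letI := conjOppositeAlgebra b
  FreeAlgebra.lift_ι_apply (fun g => MulOpposite.op (gen b g)) g

lemma freeStar_smul (b : ℝ) (c : ℂ) (x : FreeAlgebra ℂ Gen) :
    freeStar b (c • x) = starRingEnd ℂ c • freeStar b x := by
  have h : freeStar b (algebraMap ℂ _ c) = algebraMap ℂ (Uq b)ᵐᵒᵖ (starRingEnd ℂ c) :=
    letI := conjOppositeAlgebra b
    (FreeAlgebra.lift ℂ (fun g => MulOpposite.op (gen b g)) :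
      FreeAlgebra ℂ Gen →ₐ[ℂ] (Uq b)ᵐᵒᵖ).commutes c
  rw [Algebra.smul_def, map_mul, h, ← Algebra.smul_def]

lemma freeStar_rel (b : ℝ) ⦃x y : FreeAlgebra ℂ Gen⦄ (h : Rel b x y) :
    freeStar b x = freeStar b y := by
  have hq := qParam_ne_zero b
  have hq2 : (qParam b) ^ 2 ≠ 0 := pow_ne_zero 2 hq
  apply MulOpposite.unop_injective
  cases h with
  | K_Kinv => simp [freeStar_ι, gen_Kinv_K]
  | Kinv_K => simp [freeStar_ι, gen_K_Kinv]
  | K_e =>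
    simp only [map_mul, freeStar_smul, freeStar_ι, MulOpposite.unop_mul, MulOpposite.unop_op,
      MulOpposite.unop_smul, map_pow, conj_qParam, gen_K_e, smul_smul, inv_pow]
    rw [inv_mul_cancel₀ hq2, one_smul]
  | K_f =>
    simp only [map_mul, freeStar_smul, freeStar_ι, MulOpposite.unop_mul, MulOpposite.unop_op,
      MulOpposite.unop_smul, map_inv₀, map_pow, conj_qParam, gen_K_f, smul_smul, inv_pow, inv_inv]
    rw [mul_inv_cancel₀ hq2, one_smul]
  | e_f =>
    simp only [map_mul, map_sub, freeStar_smul, freeStar_ι, MulOpposite.unop_mul,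
      MulOpposite.unop_op, MulOpposite.unop_smul, MulOpposite.unop_sub, map_inv₀, conj_qParam,
      inv_inv]
    rw [← neg_sub (gen b Gen.e * gen b Gen.f), gen_e_f]
    module

/-- The star operation of the real form `U_q(sl(2,ℝ))`, as an anti-homomorphism. -/
noncomputable def starHom (b : ℝ) : Uq b →+* (Uq b)ᵐᵒᵖ :=
  RingQuot.lift ⟨freeStar b, freeStar_rel b⟩

lemma starHom_gen (b : ℝ) (g : Gen) : starHom b (gen b g) = MulOpposite.op (gen b g) := by
  rw [← freeStar_ι, starHom, ← RingQuot.lift_mkRingHom_apply (freeStar b) (freeStar_rel b),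
    ← RingQuot.mkAlgHom_coe ℂ]
  rfl

lemma starHom_smul (b : ℝ) (c : ℂ) (x : Uq b) :
    starHom b (c • x) = starRingEnd ℂ c • starHom b x := by
  obtain ⟨y, rfl⟩ := RingQuot.mkAlgHom_surjective ℂ (Rel b) x
  have key : ∀ z, starHom b (RingQuot.mkAlgHom ℂ (Rel b) z) = freeStar b z := by
    intro z
    rw [starHom, ← RingQuot.lift_mkRingHom_apply (freeStar b) (freeStar_rel b) z,
      ← RingQuot.mkAlgHom_coe ℂ]
    rfl
  rw [← map_smul, key, key, freeStar_smul]

lemma starHom_starHom (b : ℝ) (x : Uq b) :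
    (starHom b (starHom b x).unop).unop = x := by
  let Φ : Uq b →ₐ[ℂ] Uq b :=
    { toFun := fun x => (starHom b (starHom b x).unop).unop
      map_one' := by simp
      map_mul' := by intro x y; simp
      map_zero' := by simp
      map_add' := by intro x y; simp
      commutes' := by
        intro c
        simp only [Algebra.algebraMap_eq_smul_one]
        rw [starHom_smul, MulOpposite.unop_smul, starHom_smul]
        simp }
  have h : Φ = AlgHom.id ℂ (Uq b) := by
    apply RingQuot.ringQuot_ext'
    apply FreeAlgebra.hom_ext
    funext g
    change (starHom b (starHom b (gen b g)).unop).unop = gen b g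
    simp [starHom_gen]
  exact DFunLike.congr_fun h x

/-- The real form `U_q(sl(2,ℝ))`: the star structure on `U_q(sl₂)` with `e* = e`, `f* = f`,
`K* = K` (see `star_gen`), conjugate-linear and reversing products. -/
noncomputable instance instStarRingUq (b : ℝ) : StarRing (Uq b) where
  star x := (starHom b x).unop
  star_involutive := starHom_starHom b
  star_mul x y := by simp
  star_add x y := by simp

instance instStarModuleUq (b : ℝ) : StarModule ℂ (Uq b) where
  star_smul c x := by
    change (starHom b (c • x)).unop = starRingEnd ℂ c • (starHom b x).unop
    rw [starHom_smul, MulOpposite.unop_smul]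

lemma star_gen (b : ℝ) (g : Gen) : star (gen b g) = gen b g := by
  change (starHom b (gen b g)).unop = gen b g
  rw [starHom_gen, MulOpposite.unop_op]

/-! ## Unbounded operators and Borel functional calculus -/

/-- The (maximal) operator of multiplication by a function `φ` on `L²(μ)`, with domain
`{f ∈ L²(μ) | φ f ∈ L²(μ)}`. -/
noncomputable def mulOp {X : Type} [MeasurableSpace X] (μ : Measure X) (φ : X → ℂ) :
    Lp ℂ 2 μ →ₗ.[ℂ] Lp ℂ 2 μ where
  domain :=
    { carrier := {f | MemLp (fun x => φ x * f x) 2 μ}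
      add_mem' := by
        intro f g hf hg
        refine (MemLp.add hf hg).ae_eq ?_
        filter_upwards [Lp.coeFn_add f g] with x hx
        rw [hx, Pi.add_apply, Pi.add_apply, mul_add]
      zero_mem' := by
        refine (MemLp.zero' (p := 2) (μ := μ) (ε := ℂ)).ae_eq ?_
        filter_upwards [Lp.coeFn_zero ℂ 2 μ] with x hx
        rw [hx, Pi.zero_apply, mul_zero]
      smul_mem' := by
        intro c f hf
        refine (MemLp.const_smul hf c).ae_eq ?_
        filter_upwards [Lp.coeFn_smul c f] with x hx
        simp only [Pi.smul_apply, smul_eq_mul, hx]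
        ring }
  toFun :=
    { toFun := fun f => MemLp.toLp (fun x => φ x * (f : Lp ℂ 2 μ) x) f.2
      map_add' := by
        intro f g
        rw [← MemLp.toLp_add]
        apply MemLp.toLp_congr
        filter_upwards [Lp.coeFn_add (f : Lp ℂ 2 μ) (g : Lp ℂ 2 μ)] with x hx
        rw [Submodule.coe_add, hx, Pi.add_apply, Pi.add_apply, mul_add]
      map_smul' := by
        intro c f
        rw [RingHom.id_apply, ← MemLp.toLp_const_smul]
        apply MemLp.toLp_congr
        filter_upwards [Lp.coeFn_smul c (f : Lp ℂ 2 μ)] with x hx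
        simp only [Submodule.coe_smul, Pi.smul_apply, smul_eq_mul, hx]
        ring }

/-- The operator `W⁻¹ T W`, for a unitary `W`. -/
noncomputable def unitaryPull {H H' : Type} [NormedAddCommGroup H] [InnerProductSpace ℂ H]
    [NormedAddCommGroup H'] [InnerProductSpace ℂ H'] (W : H ≃ₗᵢ[ℂ] H') (T : H' →ₗ.[ℂ] H') :
    H →ₗ.[ℂ] H where
  domain := T.domain.comap W.toLinearEquiv.toLinearMap
  toFun := W.symm.toLinearEquiv.toLinearMap ∘ₗ T.toFun ∘ₗ
    (W.toLinearEquiv.toLinearMap.restrict (p := T.domain.comap W.toLinearEquiv.toLinearMap)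
      (q := T.domain) (fun _ hx => hx))

/-- `T = g(A)` in the sense of the Borel functional calculus of the self-adjoint operator `A`: in
some spectral representation of `A` as multiplication by a real function `φ`, the operator `T` is
multiplication by `g ∘ φ` (by the spectral theorem, `g(A)` does not depend on the representation).
In particular `A` is self-adjoint if such a `T` exists. -/
def IsBorelFun {H : Type} [NormedAddCommGroup H] [InnerProductSpace ℂ H]
    (A : H →ₗ.[ℂ] H) (g : ℝ → ℂ) (T : H →ₗ.[ℂ] H) : Prop :=
  ∃ (X : Type) (_ : MeasurableSpace X) (μ : Measure X) (W : H ≃ₗᵢ[ℂ] Lp ℂ 2 μ) (φ : X → ℝ),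
    Measurable φ ∧
    A = unitaryPull W (mulOp μ (fun x => (φ x : ℂ))) ∧
    T = unitaryPull W (mulOp μ (fun x => g (φ x)))

/-- `T` is a positive self-adjoint operator (with trivial kernel). -/
def IsPositiveSelfAdjoint {H : Type} [NormedAddCommGroup H] [InnerProductSpace ℂ H]
    [CompleteSpace H] (T : H →ₗ.[ℂ] H) : Prop :=
  IsSelfAdjoint T ∧ ∀ x : T.domain, x ≠ 0 → 0 < (⟪(x : H), T x⟫).re

/-- `T` is the sum of the positive self-adjoint operators `A` and `B` in the sense of quadratic
forms: `T` is the operator associated with the closed form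
`⟪A^{1/2} x, A^{1/2} z⟫ + ⟪B^{1/2} x, B^{1/2} z⟫` on `D(A^{1/2}) ∩ D(B^{1/2})`. -/
def IsFormSum {H : Type} [NormedAddCommGroup H] [InnerProductSpace ℂ H]
    (A B T : H →ₗ.[ℂ] H) : Prop :=
  ∃ RA RB : H →ₗ.[ℂ] H,
    IsBorelFun A (fun s => (Real.sqrt s : ℂ)) RA ∧
    IsBorelFun B (fun s => (Real.sqrt s : ℂ)) RB ∧
    ∀ x y : H, (x, y) ∈ T.graph ↔
      ∃ (hA : x ∈ RA.domain) (hB : x ∈ RB.domain),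
        ∀ (z : H) (hzA : z ∈ RA.domain) (hzB : z ∈ RB.domain),
          ⟪RA ⟨z, hzA⟩, RA ⟨x, hA⟩⟫ + ⟪RB ⟨z, hzB⟩, RB ⟨x, hB⟩⟫ = ⟪z, y⟫

/-- A bounded operator `X` strongly commutes with the positive self-adjoint operator `T` if it
commutes with the unitary operators `T^{it}`, `t ∈ ℝ`. -/
def StronglyCommutes {H : Type} [NormedAddCommGroup H] [InnerProductSpace ℂ H]
    (X : H →L[ℂ] H) (T : H →ₗ.[ℂ] H) : Prop :=
  ∀ (t : ℝ) (V : H →L[ℂ] H),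
    IsBorelFun T (fun s => (s : ℂ) ^ (Complex.I * (t : ℂ))) ((V : H →ₗ[ℂ] H).toPMap ⊤) →
    X ∘L V = V ∘L X

/-! ## Operators on `L²(ℝ)` -/

/-- The Hilbert space `L²(ℝ)`. -/
abbrev L2R : Type := Lp ℂ 2 (volume : Measure ℝ)

/-- The inclusion of the Schwartz space into `L²(ℝ)`. -/
noncomputable def schwartzIncl : 𝓢(ℝ, ℂ) →ₗ[ℂ] L2R :=
  (SchwartzMap.toLpCLM ℂ ℂ 2 (volume : Measure ℝ)).toLinearMap

lemma schwartzIncl_injective : Function.Injective schwartzIncl :=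
  SchwartzMap.injective_toLp 2 (volume : Measure ℝ)

/-- `α u + β p` on Schwartz functions, where `u` is multiplication by the coordinate and
`p = (1 / 2πi) d/du`. -/
noncomputable def heisenbergSchwartz (α β : ℝ) : 𝓢(ℝ, ℂ) →ₗ[ℂ] 𝓢(ℝ, ℂ) :=
  (α : ℂ) • (SchwartzMap.smulLeftCLM ℂ (fun x : ℝ => (x : ℂ)) : 𝓢(ℝ, ℂ) →L[ℂ] 𝓢(ℝ, ℂ)).toLinearMap
  + ((β : ℂ) * (1 / (2 * Real.pi * Complex.I))) •
      (SchwartzMap.derivCLM ℂ ℂ : 𝓢(ℝ, ℂ) →L[ℂ] 𝓢(ℝ, ℂ)).toLinearMap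

/-- The value of `heisenbergSchwartz` at a point (the coordinate has temperate growth, so that the
multiplication operator of the definition is the expected one). -/
lemma heisenbergSchwartz_apply (α β : ℝ) (f : 𝓢(ℝ, ℂ)) (x : ℝ) :
    heisenbergSchwartz α β f x
      = (α : ℂ) * ((x : ℂ) * f x) + (β : ℂ) * (1 / (2 * Real.pi * Complex.I) * deriv f x) := by
  have hg : (fun x : ℝ => (x : ℂ)).HasTemperateGrowth :=
    Complex.ofRealCLM.hasTemperateGrowth
  simp [heisenbergSchwartz, SchwartzMap.smulLeftCLM_apply_apply hg, mul_assoc]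

/-- The operator `α u + β p` of `L²(ℝ)` with the Schwartz space as its domain. -/
noncomputable def heisenbergCore (α β : ℝ) : L2R →ₗ.[ℂ] L2R where
  domain := LinearMap.range schwartzIncl
  toFun := schwartzIncl ∘ₗ heisenbergSchwartz α β ∘ₗ
    (LinearEquiv.ofInjective schwartzIncl schwartzIncl_injective).symm.toLinearMap

/-- The self-adjoint operator `α u + β p` on `L²(ℝ)`: the adjoint of the (essentially self-adjoint)
operator on Schwartz functions, i.e. `α u + β p` in the sense of distributions, with domain
`{h ∈ L²(ℝ) | (α u + β p) h ∈ L²(ℝ)}`. -/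
noncomputable def heisenberg (α β : ℝ) : L2R →ₗ.[ℂ] L2R := (heisenbergCore α β).adjoint

/-- The subspace of `L²(ℝ)` spanned by the entire rapidly decreasing functions
`exp (-a u² + c u) P(u)` with `a > 0`, `c ∈ ℂ` and `P` a polynomial. -/
noncomputable def gaussianSpace : Submodule ℂ L2R :=
  Submodule.span ℂ {h : L2R | ∃ (a : ℝ) (c : ℂ) (P : Polynomial ℂ), 0 < a ∧
    (h : ℝ → ℂ) =ᵐ[volume]
      fun x : ℝ => Complex.exp (-(a : ℂ) * (x : ℂ) ^ 2 + c * (x : ℂ)) * P.eval (x : ℂ)}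

/-- `T = exp (2πb (α u + β p))`. -/
def IsWeylExp (b α β : ℝ) (T : L2R →ₗ.[ℂ] L2R) : Prop :=
  IsBorelFun (heisenberg α β) (fun s => (Real.exp (2 * Real.pi * b * s) : ℂ)) T

end QuantumSL2

/-!
The exponential `exp (2πb (α u + β p))` acts on entire functions by
`F(z) ↦ exp (2πbαz - πib²αβ) F(z - ibβ)`, so that on the span of the entire Gaussian functions
`exp (-a z² + B z) P(z)` the relations of `U_q(sl₂)` and the vanishing of the Casimir element are
identities between shifts and exponential factors (`genAction_rel`, `entireRep_casimir`). The
analytic content is that this action is the one given by the functional calculus.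

* For `β ≠ 0`, multiplication by the chirp `exp (πicu²)`, `c = α / β`, followed by the Fourier
  transform is a unitary that preserves the Schwartz space and turns `α u + β p` into
  multiplication by `βξ` there. The adjoint of a multiplication operator on Schwartz functions is
  the maximal one, which diagonalises the self-adjoint operator (`heisenberg_eq_chirpFourier`) and
  with it all exponentials.
* In this representation the exponential is multiplication by `exp (2πbβξ)`. For a Gaussian function
  that multiplication is the Fourier image of an imaginary shift of the argument, because integrals
  of Gaussian functions do not depend on the horizontal line of integration
  (`gaussIntegral_eq`, `fourier_gaussFn_sub`, `mem_weylExp_graph`).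
* A symmetric operator `T ≥ 0` with `T + 1` onto is self-adjoint, and every subspace with dense
  image under `T + 1` is a core (`NonnegResolvent.isSelfAdjoint`, `NonnegResolvent.hasCore`).
  For the exponentials and the Gaussian functions, density follows from the uniqueness of Fourier
  transforms, since the images contain all modulations of one function without zeros
  (`hasCore_of_modulations`).
* The form sum is obtained from the orthogonal projection to the closed subspace of the triples
  `(x, A x, B x)`, where `A` and `B` are the square roots of the summands
  (`nonnegResolvent_formOp`).
* The powers `K^{it}` and `f^{it}` are the modulations and the translations of `L²(ℝ)`. An
  operator that commutes with the modulations is multiplication by a function, and a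
  translation-invariant function is constant (`eq_smul_id_of_comm`).
-/

namespace QuantumSL2

open Polynomial FourierTransform
open scoped ContDiff

/-! ### Nonnegative operators with `T + 1` onto -/

section Abstract

variable {H : Type} [NormedAddCommGroup H] [InnerProductSpace ℂ H]

/-- A symmetric operator with nonnegative quadratic form such that `T + 1` is onto. Over a Hilbert
space these are exactly the nonnegative self-adjoint operators. -/
structure NonnegResolvent (T : H →ₗ.[ℂ] H) : Prop where
  symm : ∀ x y : T.domain, ⟪T x, (y : H)⟫ = ⟪(x : H), T y⟫
  nonneg : ∀ x : T.domain, 0 ≤ (⟪(x : H), T x⟫).re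
  surj : ∀ h : H, ∃ x : T.domain, (x : H) + T x = h

namespace NonnegResolvent

variable {T : H →ₗ.[ℂ] H}

/-- `T` contains every operator that is formally adjoint to it: solve `(T + 1) x = h + k` and
compare `x` with `h` by pairing with the range of `T + 1`. -/
lemma mem_graph_of_formal_adjoint (hT : NonnegResolvent T) {h k : H}
    (hk : ∀ g : T.domain, ⟪k, (g : H)⟫ = ⟪h, T g⟫) : (h, k) ∈ T.graph := by
  obtain ⟨x, hx⟩ := hT.surj (h + k)
  have key : ∀ v : H, ⟪(x : H) - h, v⟫ = 0 := by
    intro v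
    obtain ⟨g, rfl⟩ := hT.surj v
    have h1 : ⟪(x : H) + T x, (g : H)⟫ = ⟪h + k, (g : H)⟫ := by rw [hx]
    rw [inner_add_left, inner_add_left, hT.symm, hk, ← inner_add_right, ← inner_add_right] at h1
    rw [inner_sub_left, h1, sub_self]
  have hxh : (x : H) = h := sub_eq_zero.mp (inner_self_eq_zero.mp (key _))
  rw [LinearPMap.mem_graph_iff]
  refine ⟨x, hxh, ?_⟩
  rw [hxh] at hx
  exact add_left_cancel hx

lemma norm_le (hT : NonnegResolvent T) (x : T.domain) : ‖(x : H)‖ ≤ ‖(x : H) + T x‖ := by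
  have h1 : ‖(x : H)‖ ^ 2 ≤ (⟪(x : H), (x : H) + T x⟫).re := by
    have h0 : (⟪(x : H), (x : H)⟫).re = ‖(x : H)‖ ^ 2 := inner_self_eq_norm_sq (𝕜 := ℂ) _
    rw [inner_add_right, Complex.add_re, h0]
    linarith [hT.nonneg x]
  have h2 : (⟪(x : H), (x : H) + T x⟫).re ≤ ‖(x : H)‖ * ‖(x : H) + T x‖ :=
    re_inner_le_norm (𝕜 := ℂ) _ _
  by_contra! hc
  nlinarith [norm_nonneg (x : H), norm_nonneg ((x : H) + T x)]

variable [CompleteSpace H]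

lemma dense_domain (hT : NonnegResolvent T) : Dense (T.domain : Set H) := by
  rw [Submodule.dense_iff_topologicalClosure_eq_top,
    Submodule.topologicalClosure_eq_top_iff, Submodule.eq_bot_iff]
  intro h hh
  rw [Submodule.mem_orthogonal] at hh
  obtain ⟨x, hx⟩ := hT.surj h
  have h1 : ⟪(x : H), (x : H) + T x⟫ = 0 := by rw [hx]; exact hh x x.2
  have h2 : ‖(x : H)‖ ^ 2 + (⟪(x : H), T x⟫).re = 0 := by
    have h0 : (⟪(x : H), (x : H)⟫).re = ‖(x : H)‖ ^ 2 := inner_self_eq_norm_sq (𝕜 := ℂ) _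
    rw [← h0, ← Complex.add_re, ← inner_add_right, h1, Complex.zero_re]
  have h3 : ‖(x : H)‖ ^ 2 = 0 := by
    have := hT.nonneg x
    nlinarith [sq_nonneg ‖(x : H)‖]
  have h4 : x = 0 := by
    have : (x : H) = 0 := by simpa using h3
    exact Subtype.ext this
  rw [← hx, h4]
  simp

lemma isSelfAdjoint (hT : NonnegResolvent T) : IsSelfAdjoint T := by
  rw [LinearPMap.isSelfAdjoint_def]
  refine le_antisymm (LinearPMap.le_of_le_graph ?_)
    (LinearPMap.IsFormalAdjoint.le_adjoint hT.dense_domain fun x y => hT.symm x y)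
  rintro ⟨h, k⟩ hk
  rw [LinearPMap.mem_graph_iff] at hk
  obtain ⟨y, rfl, rfl⟩ := hk
  exact hT.mem_graph_of_formal_adjoint fun g =>
    LinearPMap.adjoint_isFormalAdjoint hT.dense_domain y g

/-- A subspace on which `T + 1` has dense range is a core, since `(T + 1)⁻¹` is bounded. -/
lemma hasCore (hT : NonnegResolvent T) {S : Submodule ℂ H} (hS : S ≤ T.domain)
    (hd : ∀ h : H, (∀ (g : H) (hg : g ∈ S), ⟪h, g + T ⟨g, hS hg⟩⟫ = 0) → h = 0) :
    T.HasCore S := by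
  refine ⟨hS, ?_⟩
  have hcl := hT.isSelfAdjoint.isClosed
  have hle : T.domRestrict S ≤ T := LinearPMap.domRestrict_le
  have hclos : (T.domRestrict S).IsClosable := hcl.isClosable.leIsClosable hle
  apply LinearPMap.eq_of_eq_graph
  rw [← hclos.graph_closure_eq_closure_graph]
  apply le_antisymm
  · exact Submodule.topologicalClosure_minimal _ (LinearPMap.le_graph_of_le hle) hcl
  · rintro ⟨x, y⟩ hxy
    rw [LinearPMap.mem_graph_iff] at hxy
    obtain ⟨x, rfl, rfl⟩ := hxy
    -- the range of `T + 1` on `S`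
    let R : Submodule ℂ H := LinearMap.range
      (S.subtype + T.toFun ∘ₗ Submodule.inclusion hS)
    have hR : Dense (R : Set H) := by
      rw [Submodule.dense_iff_topologicalClosure_eq_top,
        Submodule.topologicalClosure_eq_top_iff, Submodule.eq_bot_iff]
      intro h hh
      rw [Submodule.mem_orthogonal'] at hh
      exact hd h fun g hg => hh _ ⟨⟨g, hg⟩, rfl⟩
    have hmem : ((x : H) + T x) ∈ closure (R : Set H) := hR _
    rw [← SetLike.mem_coe, Submodule.topologicalClosure_coe, Metric.mem_closure_iff]
    intro ε hε
    obtain ⟨r, ⟨s, rfl⟩, hr⟩ := Metric.mem_closure_iff.mp hmem (ε / 2) (by positivity)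
    have hsd : ((s : H) ∈ S ⊓ T.domain) := ⟨s.2, hS s.2⟩
    refine ⟨((s : H), T ⟨s, hS s.2⟩), ?_, ?_⟩
    · rw [SetLike.mem_coe, LinearPMap.mem_graph_iff]
      exact ⟨⟨s, hsd⟩, rfl, rfl⟩
    · set z : T.domain := x - ⟨s, hS s.2⟩ with hz
      have hz1 : (z : H) = (x : H) - s := rfl
      have hz2 : T z = T x - T ⟨s, hS s.2⟩ := LinearPMap.map_sub _ _ _
      have h3 : ‖(z : H) + T z‖ < ε / 2 := by
        rw [dist_eq_norm] at hr
        have h6 : (z : H) + T z = (x : H) + T x - ((s : H) + T ⟨s, hS s.2⟩) := by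
          rw [hz1, hz2]
          abel
        rw [h6]
        exact hr
      have h4 := hT.norm_le z
      have h5 : ‖T z‖ ≤ ‖(z : H) + T z‖ + ‖(z : H)‖ := by
        simpa using norm_sub_le ((z : H) + T z) (z : H)
      rw [Prod.dist_eq, dist_eq_norm, dist_eq_norm, ← hz1, ← hz2]
      apply max_lt <;> linarith

end NonnegResolvent

end Abstract

/-! ### Multiplication operators -/

section Mul

variable {X : Type} [MeasurableSpace X] {μ : Measure X}

lemma mem_mulOp_graph {φ : X → ℂ} {f g : Lp ℂ 2 μ} :
    (f, g) ∈ (mulOp μ φ).graph ↔ (g : X → ℂ) =ᵐ[μ] fun x => φ x * f x := by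
  rw [LinearPMap.mem_graph_iff]
  constructor
  · rintro ⟨y, rfl, rfl⟩
    exact MemLp.coeFn_toLp y.2
  · intro h
    have hf : MemLp (fun x => φ x * f x) 2 μ := (Lp.memLp g).ae_eq h
    refine ⟨⟨f, hf⟩, rfl, ?_⟩
    apply Lp.ext
    exact (MemLp.coeFn_toLp hf).trans h.symm

variable {H : Type} [NormedAddCommGroup H] [InnerProductSpace ℂ H]

lemma mem_unitaryPull_graph {H' : Type} [NormedAddCommGroup H'] [InnerProductSpace ℂ H']
    {W : H ≃ₗᵢ[ℂ] H'} {T : H' →ₗ.[ℂ] H'} {x y : H} :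
    (x, y) ∈ (unitaryPull W T).graph ↔ (W x, W y) ∈ T.graph := by
  rw [LinearPMap.mem_graph_iff, LinearPMap.mem_graph_iff]
  constructor
  · rintro ⟨z, rfl, rfl⟩
    exact ⟨⟨W z, z.2⟩, rfl, (W.apply_symm_apply _).symm⟩
  · rintro ⟨z, hz, hzy⟩
    have hx : W x ∈ T.domain := by
      have h : (z : H') = W x := hz
      exact h ▸ z.2
    refine ⟨⟨x, hx⟩, rfl, ?_⟩
    · change W.symm (T ⟨W x, hx⟩) = y
      have : (⟨W x, hx⟩ : T.domain) = z := Subtype.ext hz.symm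
      rw [this, hzy]
      exact W.symm_apply_apply y

/-- The operator that a unitary `W` turns into multiplication by the function `φ`. -/
noncomputable def diagOp (W : H ≃ₗᵢ[ℂ] Lp ℂ 2 μ) (φ : X → ℂ) : H →ₗ.[ℂ] H :=
  unitaryPull W (mulOp μ φ)

lemma mem_diagOp_graph {W : H ≃ₗᵢ[ℂ] Lp ℂ 2 μ} {φ : X → ℂ} {x y : H} :
    (x, y) ∈ (diagOp W φ).graph ↔ (W y : X → ℂ) =ᵐ[μ] fun a => φ a * W x a := by
  rw [diagOp, mem_unitaryPull_graph, mem_mulOp_graph]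

lemma diagOp_apply_ae {W : H ≃ₗᵢ[ℂ] Lp ℂ 2 μ} {φ : X → ℂ} (x : (diagOp W φ).domain) :
    (W (diagOp W φ x) : X → ℂ) =ᵐ[μ] fun a => φ a * W (x : H) a :=
  mem_diagOp_graph.mp (LinearPMap.mem_graph _ x)

lemma mem_diagOp_domain {W : H ≃ₗᵢ[ℂ] Lp ℂ 2 μ} {φ : X → ℂ} {x : H} :
    x ∈ (diagOp W φ).domain ↔ MemLp (fun a => φ a * W x a) 2 μ := Iff.rfl

lemma inner_eq_integral (W : H ≃ₗᵢ[ℂ] Lp ℂ 2 μ) (x y : H) :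
    ⟪x, y⟫ = ∫ a, starRingEnd ℂ (W x a) * W y a ∂μ := by
  rw [← W.inner_map_map, L2.inner_def]
  simp only [RCLike.inner_apply, mul_comm]

variable {W : H ≃ₗᵢ[ℂ] Lp ℂ 2 μ} {φ : X → ℝ}

lemma inner_diagOp (x : H) (y : (diagOp W (fun a => (φ a : ℂ))).domain) :
    ⟪x, diagOp W (fun a => (φ a : ℂ)) y⟫
      = ∫ a, starRingEnd ℂ (W x a) * (φ a * W (y : H) a) ∂μ := by
  rw [inner_eq_integral W]
  apply integral_congr_ae
  filter_upwards [diagOp_apply_ae y] with a ha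
  rw [ha]

lemma diagOp_symm (x y : (diagOp W (fun a => (φ a : ℂ))).domain) :
    ⟪diagOp W (fun a => (φ a : ℂ)) x, (y : H)⟫ = ⟪(x : H), diagOp W (fun a => (φ a : ℂ)) y⟫ := by
  rw [inner_diagOp, inner_eq_integral W]
  apply integral_congr_ae
  filter_upwards [diagOp_apply_ae x] with a ha
  rw [ha, map_mul, Complex.conj_ofReal]
  ring

lemma re_inner_diagOp (x : (diagOp W (fun a => (φ a : ℂ))).domain) :
    Integrable (fun a => φ a * ‖W (x : H) a‖ ^ 2) μ ∧
    (⟪(x : H), diagOp W (fun a => (φ a : ℂ)) x⟫).re = ∫ a, φ a * ‖W (x : H) a‖ ^ 2 ∂μ := by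
  have e : ∀ a, starRingEnd ℂ (W (x : H) a) * (φ a * W (x : H) a)
      = ((φ a * ‖W (x : H) a‖ ^ 2 : ℝ) : ℂ) := by
    intro a
    rw [mul_left_comm, Complex.conj_mul']
    push_cast
    ring
  have hi : Integrable (fun a => ((φ a * ‖W (x : H) a‖ ^ 2 : ℝ) : ℂ)) μ := by
    have := L2.integrable_inner (𝕜 := ℂ) (W (x : H)) (W (diagOp W (fun a => (φ a : ℂ)) x))
    refine this.congr ?_
    filter_upwards [diagOp_apply_ae x] with a ha
    rw [← e, ha, RCLike.inner_apply, mul_comm]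
  refine ⟨by simpa only [RCLike.re_eq_complex_re, Complex.ofReal_re] using hi.re, ?_⟩
  rw [inner_diagOp]
  simp_rw [e]
  rw [integral_complex_ofReal, Complex.ofReal_re]

lemma nonnegResolvent_diagOp (hφ : Measurable φ) (h0 : ∀ a, 0 ≤ φ a) :
    NonnegResolvent (diagOp W (fun a => (φ a : ℂ))) where
  symm := diagOp_symm
  nonneg x := by
    rw [(re_inner_diagOp x).2]
    exact integral_nonneg fun a => mul_nonneg (h0 a) (by positivity)
  surj h := by
    have h1 : ∀ a, 0 < 1 + φ a := fun a => by linarith [h0 a]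
    have hm : AEStronglyMeasurable (fun a => (((1 + φ a)⁻¹ : ℝ) : ℂ) * W h a) μ :=
      (Complex.measurable_ofReal.comp
        (hφ.const_add 1).inv).aestronglyMeasurable.mul (Lp.aestronglyMeasurable _)
    have hu : MemLp (fun a => (((1 + φ a)⁻¹ : ℝ) : ℂ) * W h a) 2 μ := by
      refine (Lp.memLp (W h)).of_le hm (Filter.Eventually.of_forall fun a => ?_)
      rw [norm_mul, Complex.norm_real, Real.norm_of_nonneg (inv_nonneg.mpr (h1 a).le)]
      refine mul_le_of_le_one_left (norm_nonneg _) (inv_le_one_of_one_le₀ ?_)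
      linarith [h0 a]
    have e : ∀ a, (φ a : ℂ) * ((((1 + φ a)⁻¹ : ℝ) : ℂ) * W h a)
        = W h a - (((1 + φ a)⁻¹ : ℝ) : ℂ) * W h a := by
      intro a
      have : (1 + φ a : ℂ) ≠ 0 := by exact_mod_cast (h1 a).ne'
      push_cast
      field_simp
      ring
    have hmem : (W.symm (hu.toLp _), h - W.symm (hu.toLp _)) ∈
        (diagOp W (fun a => (φ a : ℂ))).graph := by
      rw [mem_diagOp_graph, map_sub, W.apply_symm_apply]
      filter_upwards [hu.coeFn_toLp, Lp.coeFn_sub (W h) (hu.toLp _)] with a ha hb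
      rw [hb, Pi.sub_apply, ha, e]
    rw [LinearPMap.mem_graph_iff] at hmem
    obtain ⟨x, hx, hx'⟩ := hmem
    exact ⟨x, by rw [hx, hx']; exact add_sub_cancel _ _⟩

lemma isPositiveSelfAdjoint_diagOp [CompleteSpace H] (hφ : Measurable φ) (h0 : ∀ a, 0 < φ a) :
    IsPositiveSelfAdjoint (diagOp W (fun a => (φ a : ℂ))) := by
  refine ⟨(nonnegResolvent_diagOp hφ fun a => (h0 a).le).isSelfAdjoint, fun x hx => ?_⟩
  obtain ⟨hi, he⟩ := re_inner_diagOp x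
  rw [he]
  have hnn : 0 ≤ fun a => φ a * ‖W (x : H) a‖ ^ 2 := fun a =>
    mul_nonneg (h0 a).le (by positivity)
  refine lt_of_le_of_ne (integral_nonneg hnn) fun h => hx ?_
  have h2 := (integral_eq_zero_iff_of_nonneg hnn hi).mp h.symm
  have h3 : W (x : H) = 0 := by
    rw [Lp.eq_zero_iff_ae_eq_zero]
    filter_upwards [h2] with a ha
    simpa [(h0 a).ne'] using ha
  exact Subtype.ext (by simpa using h3)

end Mul

/-! ### Form sums -/

section FormSum

variable {H : Type} [NormedAddCommGroup H] [InnerProductSpace ℂ H]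

/-- The graph of the operator associated with the form `⟪A x, A z⟫ + ⟪B x, B z⟫` on
`D(A) ∩ D(B)`. -/
def formGraph (A B : H →ₗ.[ℂ] H) : Submodule ℂ (H × H) where
  carrier := {p | ∃ (hA : p.1 ∈ A.domain) (hB : p.1 ∈ B.domain),
    ∀ (z : H) (hzA : z ∈ A.domain) (hzB : z ∈ B.domain),
      ⟪A ⟨z, hzA⟩, A ⟨p.1, hA⟩⟫ + ⟪B ⟨z, hzB⟩, B ⟨p.1, hB⟩⟫ = ⟪z, p.2⟫}
  add_mem' := by
    rintro ⟨x, y⟩ ⟨x', y'⟩ ⟨hA, hB, h⟩ ⟨hA', hB', h'⟩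
    refine ⟨A.domain.add_mem hA hA', B.domain.add_mem hB hB', fun z hzA hzB => ?_⟩
    have e1 : A ⟨x + x', A.domain.add_mem hA hA'⟩ = A ⟨x, hA⟩ + A ⟨x', hA'⟩ :=
      A.map_add ⟨x, hA⟩ ⟨x', hA'⟩
    have e2 : B ⟨x + x', B.domain.add_mem hB hB'⟩ = B ⟨x, hB⟩ + B ⟨x', hB'⟩ :=
      B.map_add ⟨x, hB⟩ ⟨x', hB'⟩
    change ⟪_, A ⟨x + x', _⟩⟫ + ⟪_, B ⟨x + x', _⟩⟫ = ⟪z, y + y'⟫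
    rw [e1, e2, inner_add_right, inner_add_right, inner_add_right, ← h z hzA hzB,
      ← h' z hzA hzB]
    ring
  zero_mem' := by
    refine ⟨A.domain.zero_mem, B.domain.zero_mem, fun z hzA hzB => ?_⟩
    have e1 : A ⟨0, A.domain.zero_mem⟩ = 0 := A.map_zero
    have e2 : B ⟨0, B.domain.zero_mem⟩ = 0 := B.map_zero
    change ⟪_, A ⟨0, _⟩⟫ + ⟪_, B ⟨0, _⟩⟫ = ⟪z, 0⟫
    rw [e1, e2, inner_zero_right, inner_zero_right, inner_zero_right, add_zero]
  smul_mem' := by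
    rintro c ⟨x, y⟩ ⟨hA, hB, h⟩
    refine ⟨A.domain.smul_mem c hA, B.domain.smul_mem c hB, fun z hzA hzB => ?_⟩
    have e1 : A ⟨c • x, A.domain.smul_mem c hA⟩ = c • A ⟨x, hA⟩ := A.map_smul c ⟨x, hA⟩
    have e2 : B ⟨c • x, B.domain.smul_mem c hB⟩ = c • B ⟨x, hB⟩ := B.map_smul c ⟨x, hB⟩
    change ⟪_, A ⟨c • x, _⟩⟫ + ⟪_, B ⟨c • x, _⟩⟫ = ⟪z, c • y⟫
    rw [e1, e2, inner_smul_right, inner_smul_right, inner_smul_right, ← h z hzA hzB, mul_add]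

/-- The operator associated with the form `⟪A x, A z⟫ + ⟪B x, B z⟫` on `D(A) ∩ D(B)`. It is
meaningful when `D(A) ∩ D(B)` is dense. -/
noncomputable def formOp (A B : H →ₗ.[ℂ] H) : H →ₗ.[ℂ] H := (formGraph A B).toLinearPMap

variable {A B : H →ₗ.[ℂ] H} [CompleteSpace H]

lemma formOp_graph (hd : Dense ((A.domain ⊓ B.domain : Submodule ℂ H) : Set H)) :
    (formOp A B).graph = formGraph A B := by
  refine Submodule.toLinearPMap_graph_eq _ ?_
  rintro ⟨x, y⟩ ⟨hA, hB, h⟩ (rfl : x = 0)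
  have hy : y ∈ (A.domain ⊓ B.domain)ᗮ := by
    rw [Submodule.mem_orthogonal]
    intro z hz
    have e1 : A ⟨0, hA⟩ = 0 := A.map_zero
    have e2 : B ⟨0, hB⟩ = 0 := B.map_zero
    have := h z hz.1 hz.2
    rw [e1, e2, inner_zero_right, inner_zero_right, add_zero] at this
    exact this.symm
  rw [Submodule.dense_iff_topologicalClosure_eq_top,
    Submodule.topologicalClosure_eq_top_iff] at hd
  rwa [hd, Submodule.mem_bot] at hy

lemma mem_formOp_graph (hd : Dense ((A.domain ⊓ B.domain : Submodule ℂ H) : Set H)) (x y : H) :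
    (x, y) ∈ (formOp A B).graph ↔
      ∃ (hA : x ∈ A.domain) (hB : x ∈ B.domain),
        ∀ (z : H) (hzA : z ∈ A.domain) (hzB : z ∈ B.domain),
          ⟪A ⟨z, hzA⟩, A ⟨x, hA⟩⟫ + ⟪B ⟨z, hzB⟩, B ⟨x, hB⟩⟫ = ⟪z, y⟫ := by
  rw [formOp_graph hd]
  rfl

/-- The form of closed operators `A` and `B` defines a nonnegative self-adjoint operator: the
solution of `(T + 1) x = h` is read off from the orthogonal projection of `(h, 0, 0)` to the closed
subspace of the triples `(x, A x, B x)`. -/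
lemma nonnegResolvent_formOp (hA : A.IsClosed) (hB : B.IsClosed)
    (hd : Dense ((A.domain ⊓ B.domain : Submodule ℂ H) : Set H)) :
    NonnegResolvent (formOp A B) where
  symm x y := by
    obtain ⟨xA, xB, hx⟩ := (mem_formOp_graph hd _ _).mp (LinearPMap.mem_graph _ x)
    obtain ⟨yA, yB, hy⟩ := (mem_formOp_graph hd _ _).mp (LinearPMap.mem_graph _ y)
    rw [← hy _ xA xB, ← inner_conj_symm, ← hx _ yA yB, map_add, inner_conj_symm, inner_conj_symm]
  nonneg x := by
    obtain ⟨xA, xB, hx⟩ := (mem_formOp_graph hd _ _).mp (LinearPMap.mem_graph _ x)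
    rw [← hx _ xA xB, Complex.add_re]
    exact add_nonneg (inner_self_nonneg (𝕜 := ℂ)) (inner_self_nonneg (𝕜 := ℂ))
  surj h := by
    let V := WithLp 2 (H × WithLp 2 (H × H))
    let π₀ : V →L[ℂ] H := WithLp.fstL 2 ℂ H (WithLp 2 (H × H))
    let π₁ : V →L[ℂ] H := WithLp.fstL 2 ℂ H H ∘L WithLp.sndL 2 ℂ H (WithLp 2 (H × H))
    let π₂ : V →L[ℂ] H := WithLp.sndL 2 ℂ H H ∘L WithLp.sndL 2 ℂ H (WithLp 2 (H × H))
    let G : Submodule ℂ V := A.graph.comap (π₀.prod π₁).toLinearMap ⊓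
      B.graph.comap (π₀.prod π₂).toLinearMap
    have hG : IsClosed (G : Set V) :=
      (hA.preimage (π₀.prod π₁).continuous).inter (hB.preimage (π₀.prod π₂).continuous)
    have : CompleteSpace G := hG.completeSpace_coe
    obtain ⟨y, hy, w, hw, hyw⟩ := G.exists_add_mem_mem_orthogonal
      (WithLp.toLp 2 (h, WithLp.toLp 2 ((0 : H), (0 : H))) : V)
    have w0 : w.fst = h - y.fst := by
      rw [eq_sub_iff_add_eq, add_comm]
      exact (congrArg (fun v : V => v.fst) hyw).symm
    have w1 : w.snd.fst = - y.snd.fst := by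
      rw [eq_neg_iff_add_eq_zero, add_comm]
      exact (congrArg (fun v : V => v.snd.fst) hyw).symm
    have w2 : w.snd.snd = - y.snd.snd := by
      rw [eq_neg_iff_add_eq_zero, add_comm]
      exact (congrArg (fun v : V => v.snd.snd) hyw).symm
    have hyA : (y.fst, y.snd.fst) ∈ A.graph := hy.1
    have hyB : (y.fst, y.snd.snd) ∈ B.graph := hy.2
    have yA := LinearPMap.mem_domain_of_mem_graph hyA
    have yB := LinearPMap.mem_domain_of_mem_graph hyB
    have eA : A ⟨y.fst, yA⟩ = y.snd.fst := ((LinearPMap.image_iff yA).mpr hyA).symm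
    have eB : B ⟨y.fst, yB⟩ = y.snd.snd := ((LinearPMap.image_iff yB).mpr hyB).symm
    have hmem : (y.fst, h - y.fst) ∈ (formOp A B).graph := by
      rw [mem_formOp_graph hd]
      refine ⟨yA, yB, fun z zA zB => ?_⟩
      have hz : (WithLp.toLp 2 (z, WithLp.toLp 2 (A ⟨z, zA⟩, B ⟨z, zB⟩)) : V) ∈ G :=
        ⟨LinearPMap.mem_graph A ⟨z, zA⟩, LinearPMap.mem_graph B ⟨z, zB⟩⟩
      have h0 := (Submodule.mem_orthogonal _ _).mp hw _ hz
      rw [WithLp.prod_inner_apply, WithLp.prod_inner_apply] at h0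
      change ⟪z, w.fst⟫ + (⟪A ⟨z, zA⟩, w.snd.fst⟫ + ⟪B ⟨z, zB⟩, w.snd.snd⟫) = 0 at h0
      rw [w0, w1, w2, inner_neg_right, inner_neg_right] at h0
      rw [eA, eB]
      linear_combination -h0
    rw [LinearPMap.mem_graph_iff] at hmem
    obtain ⟨x, hx, hx'⟩ := hmem
    exact ⟨x, by rw [hx, hx']; exact add_sub_cancel _ _⟩

lemma isPositiveSelfAdjoint_formOp (hA : A.IsClosed) (hB : B.IsClosed)
    (hd : Dense ((A.domain ⊓ B.domain : Submodule ℂ H) : Set H))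
    (hker : ∀ x : A.domain, A x = 0 → x = 0) :
    IsPositiveSelfAdjoint (formOp A B) := by
  refine ⟨(nonnegResolvent_formOp hA hB hd).isSelfAdjoint, fun x hx0 => ?_⟩
  obtain ⟨xA, xB, hx⟩ := (mem_formOp_graph hd _ _).mp (LinearPMap.mem_graph _ x)
  rw [← hx _ xA xB, Complex.add_re]
  refine add_pos_of_pos_of_nonneg ?_ (inner_self_nonneg (𝕜 := ℂ))
  refine lt_of_le_of_ne (inner_self_nonneg (𝕜 := ℂ)) fun h => hx0 ?_
  have h1 : ‖A ⟨x, xA⟩‖ ^ 2 = 0 := (inner_self_eq_norm_sq (𝕜 := ℂ) _).symm.trans h.symm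
  have h2 := hker ⟨x, xA⟩ (by simpa using h1)
  exact Subtype.ext (congrArg (fun v : A.domain => (v : H)) h2)

end FormSum

section SqrtForm

variable {H : Type} [NormedAddCommGroup H] [InnerProductSpace ℂ H]
  {X : Type} [MeasurableSpace X] {μ : Measure X}

lemma isBorelFun_diagOp (W : H ≃ₗᵢ[ℂ] Lp ℂ 2 μ) {φ : X → ℝ} (hφ : Measurable φ) (g : ℝ → ℂ) :
    IsBorelFun (diagOp W (fun a => (φ a : ℂ))) g (diagOp W (fun a => g (φ a))) :=
  ⟨X, _, μ, W, φ, hφ, rfl, rfl⟩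

variable {W : H ≃ₗᵢ[ℂ] Lp ℂ 2 μ} {φ : X → ℝ}

lemma diagOp_domain_le_sqrt (hφ : Measurable φ) (h0 : ∀ a, 0 ≤ φ a) :
    (diagOp W (fun a => (φ a : ℂ))).domain
      ≤ (diagOp W (fun a => (Real.sqrt (φ a) : ℂ))).domain := by
  intro x hx
  rw [mem_diagOp_domain] at hx ⊢
  have hm : AEStronglyMeasurable (fun a => (Real.sqrt (φ a) : ℂ) * W x a) μ :=
    (Complex.measurable_ofReal.comp hφ.sqrt).aestronglyMeasurable.mul (Lp.aestronglyMeasurable _)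
  refine (hx.norm.add (Lp.memLp (W x)).norm).of_le hm (Filter.Eventually.of_forall fun a => ?_)
  have h1 : Real.sqrt (φ a) ≤ φ a + 1 := by
    nlinarith [Real.sq_sqrt (h0 a), sq_nonneg (Real.sqrt (φ a) - 1), Real.sqrt_nonneg (φ a)]
  rw [Pi.add_apply, norm_mul, norm_mul, Complex.norm_real, Complex.norm_real,
    Real.norm_of_nonneg (h0 a), Real.norm_of_nonneg (Real.sqrt_nonneg _)]
  refine le_trans ?_ (le_abs_self _)
  nlinarith [norm_nonneg (W x a)]

lemma inner_sqrt_diagOp (h0 : ∀ a, 0 ≤ φ a)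
    (z x : (diagOp W (fun a => (Real.sqrt (φ a) : ℂ))).domain)
    (x' : (diagOp W (fun a => (φ a : ℂ))).domain) (hx : (x : H) = x') :
    ⟪diagOp W (fun a => (Real.sqrt (φ a) : ℂ)) z, diagOp W (fun a => (Real.sqrt (φ a) : ℂ)) x⟫
      = ⟪(z : H), diagOp W (fun a => (φ a : ℂ)) x'⟫ := by
  rw [inner_eq_integral W, inner_diagOp]
  apply integral_congr_ae
  filter_upwards [diagOp_apply_ae x, diagOp_apply_ae z] with a ha hb
  rw [ha, hb, map_mul, Complex.conj_ofReal, hx]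
  have : (Real.sqrt (φ a) : ℂ) * Real.sqrt (φ a) = φ a := by
    rw [← Complex.ofReal_mul, Real.mul_self_sqrt (h0 a)]
  rw [← this]
  ring

end SqrtForm

section TwoDiag

variable {H : Type} [NormedAddCommGroup H] [InnerProductSpace ℂ H] [CompleteSpace H]
  {X Y : Type} [MeasurableSpace X] [MeasurableSpace Y] {μ : Measure X} {ν : Measure Y}
  {W : H ≃ₗᵢ[ℂ] Lp ℂ 2 μ} {V : H ≃ₗᵢ[ℂ] Lp ℂ 2 ν} {φ : X → ℝ} {ψ : Y → ℝ}

/-- Two strictly positive operators that are each diagonal, in bases that may differ, and have a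
dense common domain possess a form sum; it is a positive self-adjoint extension of the operator
sum. -/
lemma exists_formSum_diagOp (hφ : Measurable φ) (hψ : Measurable ψ) (h0 : ∀ a, 0 < φ a)
    (h1 : ∀ a, 0 < ψ a)
    (hd : Dense (((diagOp W (fun a => (φ a : ℂ))).domain ⊓
      (diagOp V (fun a => (ψ a : ℂ))).domain : Submodule ℂ H) : Set H)) :
    ∃ e : H →ₗ.[ℂ] H,
      IsFormSum (diagOp W (fun a => (φ a : ℂ))) (diagOp V (fun a => (ψ a : ℂ))) e ∧
      diagOp W (fun a => (φ a : ℂ)) + diagOp V (fun a => (ψ a : ℂ)) ≤ e ∧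
      IsPositiveSelfAdjoint e := by
  have leA := diagOp_domain_le_sqrt (W := W) hφ fun a => (h0 a).le
  have leB := diagOp_domain_le_sqrt (W := V) hψ fun a => (h1 a).le
  set RA := diagOp W (fun a => (Real.sqrt (φ a) : ℂ)) with hRA
  set RB := diagOp V (fun a => (Real.sqrt (ψ a) : ℂ)) with hRB
  have hd' : Dense ((RA.domain ⊓ RB.domain : Submodule ℂ H) : Set H) :=
    hd.mono (inf_le_inf leA leB)
  have hA : RA.IsClosed :=
    (nonnegResolvent_diagOp hφ.sqrt fun a => Real.sqrt_nonneg _).isSelfAdjoint.isClosed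
  have hB : RB.IsClosed :=
    (nonnegResolvent_diagOp hψ.sqrt fun a => Real.sqrt_nonneg _).isSelfAdjoint.isClosed
  refine ⟨formOp RA RB, ⟨RA, RB, isBorelFun_diagOp W hφ _, isBorelFun_diagOp V hψ _,
    mem_formOp_graph hd'⟩, ?_, ?_⟩
  · apply LinearPMap.le_of_le_graph
    rintro ⟨x, y⟩ hxy
    rw [LinearPMap.mem_graph_iff] at hxy
    obtain ⟨x, rfl, rfl⟩ := hxy
    rw [mem_formOp_graph hd']
    refine ⟨leA x.2.1, leB x.2.2, fun z zA zB => ?_⟩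
    rw [LinearPMap.add_apply, inner_add_right]
    congr 1
    · exact inner_sqrt_diagOp (fun a => (h0 a).le) ⟨z, zA⟩ ⟨x, leA x.2.1⟩ ⟨x, x.2.1⟩ rfl
    · exact inner_sqrt_diagOp (fun a => (h1 a).le) ⟨z, zB⟩ ⟨x, leB x.2.2⟩ ⟨x, x.2.2⟩ rfl
  · refine isPositiveSelfAdjoint_formOp hA hB hd' fun x hx => ?_
    by_contra hne
    have := (isPositiveSelfAdjoint_diagOp (W := W) hφ.sqrt
      fun a => Real.sqrt_pos.mpr (h0 a)).2 x hne
    have h2 : ⟪(x : H), RA x⟫ = 0 := by rw [hx, inner_zero_right]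
    exact this.ne' (congrArg Complex.re h2)

end TwoDiag

/-! ### Gaussian functions -/


/-- The entire function `exp (-A z² + B z) P(z)`. -/
noncomputable def gaussFn (A B : ℂ) (P : ℂ[X]) (z : ℂ) : ℂ :=
  Complex.exp (-A * z ^ 2 + B * z) * P.eval z

/-- The polynomial factor of the derivative of `gaussFn A B P`. -/
noncomputable def gaussDeriv (A B : ℂ) (P : ℂ[X]) : ℂ[X] :=
  derivative P + (C B - C (2 * A) * X) * P

lemma hasDerivAt_gaussFn (A B : ℂ) (P : ℂ[X]) (z : ℂ) :
    HasDerivAt (gaussFn A B P) (gaussFn A B (gaussDeriv A B P) z) z := by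
  have h1 : HasDerivAt (fun z : ℂ => -A * z ^ 2 + B * z) (-A * (2 * z) + B) z := by
    have h2 := ((hasDerivAt_pow 2 z).const_mul (-A)).add ((hasDerivAt_id z).const_mul B)
    exact h2.congr_deriv (by simp)
  refine (h1.cexp.mul (P.hasDerivAt z)).congr_deriv ?_
  simp only [gaussFn, gaussDeriv, eval_add, eval_mul, eval_sub, eval_C, eval_X]
  ring

lemma hasDerivAt_gaussFn_real (A B : ℂ) (P : ℂ[X]) (s : ℂ) (x : ℝ) :
    HasDerivAt (fun x : ℝ => gaussFn A B P (x + s)) (gaussFn A B (gaussDeriv A B P) (x + s)) x := by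
  have h1 : HasDerivAt (fun z : ℂ => gaussFn A B P (z + s))
      (gaussFn A B (gaussDeriv A B P) (x + s)) (x : ℂ) :=
    (hasDerivAt_gaussFn A B P (x + s)).comp_add_const _ _
  exact h1.comp_ofReal

lemma iteratedDeriv_gaussFn (A B : ℂ) (P : ℂ[X]) (n : ℕ) :
    iteratedDeriv n (fun x : ℝ => gaussFn A B P x)
      = fun x : ℝ => gaussFn A B ((gaussDeriv A B)^[n] P) x := by
  induction n with
  | zero => simp
  | succ n ih =>
    rw [iteratedDeriv_succ, ih, Function.iterate_succ_apply']
    funext x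
    simpa using (hasDerivAt_gaussFn_real A B ((gaussDeriv A B)^[n] P) 0 x).deriv

lemma contDiff_gaussFn (A B : ℂ) (P : ℂ[X]) {n : WithTop ℕ∞} :
    ContDiff ℝ n (fun x : ℝ => gaussFn A B P x) := by
  have h : ContDiff ℂ n (gaussFn A B P) := by
    have hP : ContDiff ℂ n (fun z => P.eval z) := by
      simpa using P.contDiff_aeval (𝕜 := ℂ) (R := ℂ) n
    unfold gaussFn
    exact (Complex.contDiff_exp.comp (by fun_prop)).mul hP
  exact (h.restrict_scalars ℝ).comp Complex.ofRealCLM.contDiff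

lemma exists_norm_eval_le (P : ℂ[X]) :
    ∃ (k : ℕ) (c : ℝ), 0 ≤ c ∧ ∀ x : ℝ, ‖P.eval (x : ℂ)‖ ≤ c * (1 + ‖x‖) ^ k := by
  induction P using Polynomial.induction_on' with
  | add P Q hP hQ =>
    obtain ⟨k, c, hc, h⟩ := hP
    obtain ⟨l, d, hd, h'⟩ := hQ
    refine ⟨k + l, c + d, by positivity, fun x => ?_⟩
    have h1 : 1 ≤ 1 + ‖x‖ := by linarith [norm_nonneg x]
    have e1 : (1 + ‖x‖) ^ k ≤ (1 + ‖x‖) ^ (k + l) := pow_le_pow_right₀ h1 (by omega)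
    have e2 : (1 + ‖x‖) ^ l ≤ (1 + ‖x‖) ^ (k + l) := pow_le_pow_right₀ h1 (by omega)
    rw [eval_add, add_mul]
    refine (norm_add_le _ _).trans (add_le_add ((h x).trans ?_) ((h' x).trans ?_)) <;> gcongr
  | monomial n a =>
    refine ⟨n, ‖a‖, norm_nonneg _, fun x => ?_⟩
    rw [eval_monomial, norm_mul, norm_pow, Complex.norm_real]
    gcongr
    linarith

lemma norm_gaussFn (A B : ℂ) (P : ℂ[X]) (x : ℝ) :
    ‖gaussFn A B P x‖ = Real.exp (-A.re * x ^ 2 + B.re * x) * ‖P.eval (x : ℂ)‖ := by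
  rw [gaussFn, norm_mul, Complex.norm_exp]
  congr 2
  have : -A * (x : ℂ) ^ 2 + B * x = -A * ((x ^ 2 : ℝ) : ℂ) + B * (x : ℂ) := by push_cast; ring
  rw [this, Complex.add_re, Complex.re_mul_ofReal, Complex.re_mul_ofReal, Complex.neg_re]

lemma exists_norm_gaussFn_le {A : ℂ} (hA : 0 < A.re) (B : ℂ) (P : ℂ[X]) :
    ∃ c : ℝ, ∀ x : ℝ, ‖gaussFn A B P x‖ ≤ c := by
  obtain ⟨k, c, hc, h⟩ := exists_norm_eval_le P
  set β := |B.re| + 1 with hβ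
  refine ⟨Real.exp (β ^ 2 / (4 * A.re) + 1) * (c * k.factorial), fun x => ?_⟩
  have h1 : (1 + ‖x‖) ^ k ≤ Real.exp (1 + ‖x‖) * k.factorial := by
    have := Real.pow_div_factorial_le_exp (1 + ‖x‖) (by positivity) k
    rwa [div_le_iff₀ (by positivity)] at this
  -- the maximum of `-a r² + β r` over real `r` is `β² / (4a)`
  have h2 : -A.re * x ^ 2 + B.re * x + (1 + ‖x‖) ≤ β ^ 2 / (4 * A.re) + 1 := by
    have e1 : B.re * x ≤ |B.re| * ‖x‖ := by
      rw [Real.norm_eq_abs, ← abs_mul]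
      exact le_abs_self _
    have e2 : x ^ 2 = ‖x‖ ^ 2 := by simp
    have e3 : β * ‖x‖ - A.re * ‖x‖ ^ 2 ≤ β ^ 2 / (4 * A.re) := by
      rw [le_div_iff₀ (by positivity)]
      nlinarith [sq_nonneg (2 * A.re * ‖x‖ - β)]
    rw [e2]
    nlinarith
  rw [norm_gaussFn]
  calc Real.exp (-A.re * x ^ 2 + B.re * x) * ‖P.eval (x : ℂ)‖
      ≤ Real.exp (-A.re * x ^ 2 + B.re * x) * (c * (Real.exp (1 + ‖x‖) * k.factorial)) := by
        gcongr
        exact (h x).trans (by gcongr)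
    _ = Real.exp (-A.re * x ^ 2 + B.re * x + (1 + ‖x‖)) * (c * k.factorial) := by
        rw [Real.exp_add (-A.re * x ^ 2 + B.re * x)]
        ring
    _ ≤ _ := by gcongr

/-- `gaussFn A B P` on the real line, as a Schwartz function. -/
noncomputable def gaussSchwartz {A : ℂ} (hA : 0 < A.re) (B : ℂ) (P : ℂ[X]) : 𝓢(ℝ, ℂ) where
  toFun x := gaussFn A B P x
  smooth' := contDiff_gaussFn A B P
  decay' k n := by
    obtain ⟨c, hc⟩ := exists_norm_gaussFn_le hA B (X ^ k * (gaussDeriv A B)^[n] P)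
    refine ⟨c, fun x => ?_⟩
    rw [norm_iteratedFDeriv_eq_norm_iteratedDeriv, iteratedDeriv_gaussFn]
    refine le_trans (le_of_eq ?_) (hc x)
    simp only [gaussFn, eval_mul, eval_pow, eval_X, norm_mul, norm_pow, Complex.norm_real]
    ring

@[simp] lemma gaussSchwartz_apply {A : ℂ} (hA : 0 < A.re) (B : ℂ) (P : ℂ[X]) (x : ℝ) :
    gaussSchwartz hA B P x = gaussFn A B P x := rfl

lemma hasTemperateGrowth_gaussFn {A : ℂ} (hA : A.re = 0) :
    (fun x : ℝ => gaussFn A 0 1 x).HasTemperateGrowth := by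
  refine ⟨contDiff_gaussFn A 0 1, fun n => ?_⟩
  obtain ⟨k, c, -, h⟩ := exists_norm_eval_le ((gaussDeriv A 0)^[n] 1)
  refine ⟨k, c, fun x => ?_⟩
  rw [norm_iteratedFDeriv_eq_norm_iteratedDeriv, iteratedDeriv_gaussFn]
  simpa [norm_gaussFn, hA] using h x

lemma gaussFn_add (A B : ℂ) (P : ℂ[X]) (z s : ℂ) :
    gaussFn A B P (z + s) = Complex.exp (-A * s ^ 2 + B * s)
      * gaussFn A (B - 2 * A * s) (P.comp (X + C s)) z := by
  simp only [gaussFn, eval_comp, eval_add, eval_X, eval_C]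
  rw [← mul_assoc, ← Complex.exp_add]
  congr 2
  ring

lemma integrable_gaussFn {A : ℂ} (hA : 0 < A.re) (B : ℂ) (P : ℂ[X]) (s : ℂ) :
    Integrable (fun x : ℝ => gaussFn A B P (x + s)) := by
  simp_rw [gaussFn_add]
  exact (gaussSchwartz hA (B - 2 * A * s) (P.comp (X + C s))).integrable.const_mul _

/-- The integral over the horizontal line through `s`, as a linear functional of the polynomial
factor. -/
noncomputable def gaussIntegral {A : ℂ} (hA : 0 < A.re) (B s : ℂ) : ℂ[X] →ₗ[ℂ] ℂ where
  toFun P := ∫ x : ℝ, gaussFn A B P (x + s)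
  map_add' P Q := by
    rw [← integral_add (integrable_gaussFn hA B P s) (integrable_gaussFn hA B Q s)]
    simp only [gaussFn, eval_add, mul_add]
  map_smul' c P := by
    rw [RingHom.id_apply, smul_eq_mul, ← integral_const_mul]
    simp only [gaussFn, eval_smul, smul_eq_mul]
    congr 1
    funext x
    ring

lemma gaussIntegral_gaussDeriv {A : ℂ} (hA : 0 < A.re) (B s : ℂ) (P : ℂ[X]) :
    gaussIntegral hA B s (gaussDeriv A B P) = 0 :=
  integral_eq_zero_of_hasDerivAt_of_integrable (hasDerivAt_gaussFn_real A B P s)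
    (integrable_gaussFn hA B _ s) (integrable_gaussFn hA B P s)

lemma gaussIntegral_one {A : ℂ} (hA : 0 < A.re) (B s : ℂ) :
    gaussIntegral hA B s 1 = (Real.pi / A) ^ (1 / 2 : ℂ) * Complex.exp (B ^ 2 / (4 * A)) := by
  have hA0 : A ≠ 0 := by rintro rfl; simp at hA
  change ∫ x : ℝ, gaussFn A B 1 (x + s) = _
  have e : ∀ x : ℝ, gaussFn A B 1 (x + s)
      = Complex.exp (-A * x ^ 2 + (B - 2 * A * s) * x + (-A * s ^ 2 + B * s)) := by
    intro x
    simp only [gaussFn, eval_one, mul_one]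
    congr 1
    ring
  simp_rw [e]
  rw [integral_cexp_quadratic (by simpa using hA), neg_neg]
  congr 2
  field_simp
  ring

/-- The integral of a Gaussian function over a horizontal line does not depend on the line. The
derivatives of Gaussian functions integrate to zero, which reduces the polynomial factor to a
constant; for constants the integral is known in closed form. -/
lemma gaussIntegral_eq {A : ℂ} (hA : 0 < A.re) (B s t : ℂ) :
    gaussIntegral hA B s = gaussIntegral hA B t := by
  have hA0 : A ≠ 0 := by rintro rfl; simp at hA
  have key : ∀ n : ℕ, gaussIntegral hA B s (X ^ n) = gaussIntegral hA B t (X ^ n) ∧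
      gaussIntegral hA B s (X ^ (n + 1)) = gaussIntegral hA B t (X ^ (n + 1)) := by
    have step : ∀ n : ℕ, gaussDeriv A B (X ^ n)
        = (n : ℂ) • (X : ℂ[X]) ^ (n - 1) + B • (X : ℂ[X]) ^ n - (2 * A) • (X : ℂ[X]) ^ (n + 1) := by
      intro n
      simp only [gaussDeriv, derivative_X_pow, smul_eq_C_mul]
      ring
    have rec' : ∀ n : ℕ, ∀ r : ℂ, (2 * A) * gaussIntegral hA B r (X ^ (n + 1))
        = n * gaussIntegral hA B r (X ^ (n - 1)) + B * gaussIntegral hA B r (X ^ n) := by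
      intro n r
      have := gaussIntegral_gaussDeriv hA B r (X ^ n)
      rw [step, map_sub, map_add, map_smul, map_smul, map_smul, smul_eq_mul, smul_eq_mul,
        smul_eq_mul] at this
      linear_combination -this
    have h2A : (2 * A) ≠ 0 := mul_ne_zero two_ne_zero hA0
    intro n
    induction n with
    | zero =>
      have h0 : gaussIntegral hA B s (X ^ 0) = gaussIntegral hA B t (X ^ 0) := by
        rw [pow_zero, gaussIntegral_one, gaussIntegral_one]
      refine ⟨h0, mul_left_cancel₀ h2A ?_⟩
      rw [rec', rec', h0]
    | succ n ih =>
      refine ⟨ih.2, mul_left_cancel₀ h2A ?_⟩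
      rw [rec', rec', ih.2, Nat.add_sub_cancel, ih.1]
  apply Polynomial.lhom_ext'
  intro n
  ext
  simpa [← X_pow_eq_monomial] using (key n).1

lemma integral_gaussFn_add {A : ℂ} (hA : 0 < A.re) (B s : ℂ) (P : ℂ[X]) :
    ∫ x : ℝ, gaussFn A B P (x + s) = ∫ x : ℝ, gaussFn A B P x := by
  have := LinearMap.congr_fun (gaussIntegral_eq hA B s 0) P
  simpa [gaussIntegral] using this

/-- The Fourier transform turns the shift of a Gaussian function by the imaginary number `-it` into
multiplication by `exp (2πtξ)`. -/
lemma fourier_gaussFn_sub {A : ℂ} (hA : 0 < A.re) (B : ℂ) (P : ℂ[X]) (t ξ : ℝ) :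
    𝓕 (fun x : ℝ => gaussFn A B P (x - Complex.I * t)) ξ
      = Complex.exp (2 * Real.pi * t * ξ) * 𝓕 (fun x : ℝ => gaussFn A B P x) ξ := by
  rw [Real.fourier_real_eq_integral_exp_smul, Real.fourier_real_eq_integral_exp_smul]
  have e : ∀ z : ℂ, Complex.exp (-2 * Real.pi * Complex.I * ξ * z) * gaussFn A B P z
      = gaussFn A (B - 2 * Real.pi * Complex.I * ξ) P z := by
    intro z
    rw [gaussFn, gaussFn, ← mul_assoc, ← Complex.exp_add]
    congr 2
    ring
  have h := integral_gaussFn_add hA (B - 2 * Real.pi * Complex.I * ξ) (-Complex.I * t) P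
  have e1 : ∀ x : ℝ, Complex.exp (((-2 * Real.pi * x * ξ : ℝ) : ℂ) * Complex.I) • gaussFn A B P x
      = gaussFn A (B - 2 * Real.pi * Complex.I * ξ) P x := by
    intro x
    rw [← e, smul_eq_mul]
    congr 2
    push_cast
    ring
  have e2 : ∀ x : ℝ, Complex.exp (((-2 * Real.pi * x * ξ : ℝ) : ℂ) * Complex.I)
        • gaussFn A B P (x - Complex.I * t)
      = Complex.exp (2 * Real.pi * t * ξ)
        * gaussFn A (B - 2 * Real.pi * Complex.I * ξ) P (x + -Complex.I * t) := by
    intro x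
    rw [← e, smul_eq_mul, ← mul_assoc, ← Complex.exp_add]
    have e3 : (x : ℂ) - Complex.I * t = x + -Complex.I * t := by ring
    rw [e3]
    congr 2
    push_cast
    linear_combination (-2 * Real.pi * t * ξ : ℂ) * Complex.I_sq
  simp_rw [e1, e2]
  rw [integral_const_mul, h]

lemma fourier_gaussFn_one {A : ℂ} (hA : 0 < A.re) (B : ℂ) (ξ : ℝ) :
    𝓕 (fun x : ℝ => gaussFn A B 1 x) ξ
      = (Real.pi / A) ^ (1 / 2 : ℂ)
        * Complex.exp ((B - 2 * Real.pi * Complex.I * ξ) ^ 2 / (4 * A)) := by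
  rw [Real.fourier_real_eq_integral_exp_smul, ← gaussIntegral_one hA _ 0]
  change _ = ∫ x : ℝ, gaussFn A (B - 2 * Real.pi * Complex.I * ξ) 1 (x + 0)
  congr 1
  funext x
  rw [add_zero, gaussFn, gaussFn, smul_eq_mul, ← mul_assoc, ← Complex.exp_add]
  congr 2
  push_cast
  ring

/-! ### Uniqueness of Fourier transforms -/

/-- An integrable function whose Fourier transform vanishes is zero: it pairs to zero with the
Fourier transforms of Schwartz functions, that is, with all Schwartz functions. -/
lemma ae_eq_zero_of_integral_exp_mul_eq_zero {h : ℝ → ℂ} (hh : Integrable h)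
    (h0 : ∀ s : ℝ, ∫ x : ℝ, Complex.exp (Complex.I * s * x) * h x = 0) : h =ᵐ[volume] 0 := by
  have hF : ∀ ξ, 𝓕 h ξ = 0 := by
    intro ξ
    rw [Real.fourier_real_eq_integral_exp_smul, ← h0 (-2 * Real.pi * ξ)]
    congr 1
    funext x
    rw [smul_eq_mul]
    congr 2
    push_cast
    ring
  apply ae_eq_zero_of_integral_contDiff_smul_eq_zero hh.locallyIntegrable
  intro g hg hgc
  have hg₁ : HasCompactSupport (Complex.ofRealCLM ∘ g) := hgc.comp_left rfl
  have hg₂ : ContDiff ℝ ∞ (Complex.ofRealCLM ∘ g) := by fun_prop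
  set ψ : 𝓢(ℝ, ℂ) := hg₁.toSchwartzMap hg₂ with hψ
  have key : ∫ ξ, 𝓕 (𝓕⁻ ψ) ξ • h ξ = ∫ x, 𝓕⁻ ψ x • 𝓕 h x := by
    have := VectorFourier.integral_fourierIntegral_smul_eq_flip (L := innerₗ ℝ)
      (μ := volume) (ν := volume) Real.continuous_fourierChar continuous_inner
      (𝓕⁻ ψ).integrable hh
    rw [flip_innerₗ] at this
    exact this
  simp only [hF, smul_zero, integral_zero, FourierTransform.fourier_fourierInv_eq] at key
  rw [← key]
  congr 1

/-! ### The unitary that diagonalises `α u + β p` -/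

/-- Multiplication by a measurable function of absolute value one, as a unitary of `L²`. -/
noncomputable def unimodMul {X : Type} [MeasurableSpace X] {μ : Measure X} (u : X → ℂ)
    (hu : Measurable u) (h1 : ∀ x, ‖u x‖ = 1) : Lp ℂ 2 μ ≃ₗᵢ[ℂ] Lp ℂ 2 μ :=
  have hmem : ∀ (v : X → ℂ), Measurable v → (∀ x, ‖v x‖ = 1) → ∀ f : Lp ℂ 2 μ,
      MemLp (fun x => v x * f x) 2 μ := fun v hv h f =>
    (Lp.memLp f).of_le (hv.aestronglyMeasurable.mul (Lp.aestronglyMeasurable f))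
      (Filter.Eventually.of_forall fun x => by rw [norm_mul, h, one_mul])
  have hc : Measurable fun x => starRingEnd ℂ (u x) := Complex.continuous_conj.measurable.comp hu
  have hc1 : ∀ x, ‖starRingEnd ℂ (u x)‖ = 1 := fun x => by rw [Complex.norm_conj, h1]
  have hcu : ∀ x, starRingEnd ℂ (u x) * u x = 1 := fun x => by
    rw [Complex.conj_mul', h1]; norm_num
  { toFun := fun f => (hmem u hu h1 f).toLp _
    invFun := fun f => (hmem _ hc hc1 f).toLp _
    map_add' := fun f g => by
      rw [← MemLp.toLp_add]
      apply MemLp.toLp_congr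
      filter_upwards [Lp.coeFn_add f g] with x hx
      rw [hx, Pi.add_apply, Pi.add_apply, mul_add]
    map_smul' := fun c f => by
      rw [RingHom.id_apply, ← MemLp.toLp_const_smul]
      apply MemLp.toLp_congr
      filter_upwards [Lp.coeFn_smul c f] with x hx
      rw [hx, Pi.smul_apply, Pi.smul_apply, smul_eq_mul, smul_eq_mul, mul_left_comm]
    left_inv := fun f => by
      apply Lp.ext
      filter_upwards [(hmem _ hc hc1 ((hmem u hu h1 f).toLp _)).coeFn_toLp,
        (hmem u hu h1 f).coeFn_toLp] with x hx hx'
      rw [hx, hx', ← mul_assoc, hcu, one_mul]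
    right_inv := fun f => by
      apply Lp.ext
      filter_upwards [(hmem _ hu h1 ((hmem _ hc hc1 f).toLp _)).coeFn_toLp,
        (hmem _ hc hc1 f).coeFn_toLp] with x hx hx'
      rw [hx, hx', ← mul_assoc, mul_comm (u x), hcu, one_mul]
    norm_map' := fun f => by
      change ‖(hmem u hu h1 f).toLp _‖ = ‖f‖
      rw [Lp.norm_toLp, Lp.norm_def]
      congr 1
      exact eLpNorm_congr_norm_ae (Filter.Eventually.of_forall fun x => by
        rw [norm_mul, h1, one_mul]) }

lemma coeFn_unimodMul {X : Type} [MeasurableSpace X] {μ : Measure X} (u : X → ℂ)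
    (hu : Measurable u) (h1 : ∀ x, ‖u x‖ = 1) (f : Lp ℂ 2 μ) :
    (unimodMul u hu h1 f : X → ℂ) =ᵐ[μ] fun x => u x * f x :=
  MemLp.coeFn_toLp ((Lp.memLp f).of_le
    (hu.aestronglyMeasurable.mul (Lp.aestronglyMeasurable f))
    (Filter.Eventually.of_forall fun x => by rw [Pi.mul_apply, norm_mul, h1, one_mul]))

/-- The chirp `exp (π i c x²)`. -/
noncomputable def chirp (c : ℝ) (x : ℝ) : ℂ := gaussFn (-(Complex.I * Real.pi * c)) 0 1 x

lemma chirp_eq (c x : ℝ) : chirp c x = Complex.exp (Complex.I * Real.pi * c * x ^ 2) := by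
  simp [chirp, gaussFn]

lemma chirp_re (c : ℝ) : (-(Complex.I * Real.pi * c)).re = 0 := by simp

lemma norm_chirp (c x : ℝ) : ‖chirp c x‖ = 1 := by
  rw [chirp, norm_gaussFn, chirp_re]
  simp

lemma continuous_chirp (c : ℝ) : Continuous (chirp c) :=
  (contDiff_gaussFn (n := 0) _ 0 1).continuous

lemma hasTemperateGrowth_chirp (c : ℝ) : (chirp c).HasTemperateGrowth :=
  hasTemperateGrowth_gaussFn (chirp_re c)

lemma chirp_neg_mul (c x : ℝ) : chirp (-c) x * chirp c x = 1 := by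
  rw [chirp_eq, chirp_eq, ← Complex.exp_add]
  simp

lemma hasDerivAt_chirp (c x : ℝ) :
    HasDerivAt (chirp c) (2 * Real.pi * Complex.I * c * x * chirp c x) x := by
  have h := hasDerivAt_gaussFn_real (-(Complex.I * Real.pi * c)) 0 1 0 x
  simp only [add_zero] at h
  refine h.congr_deriv ?_
  simp only [chirp, gaussFn, gaussDeriv, eval_add, eval_mul, eval_sub, eval_C, eval_X, eval_one,
    derivative_one, eval_zero]
  ring

/-- The unitary `h ↦ 𝓕 (exp (π i c u²) h)`: it turns `c u + p` into multiplication by the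
coordinate. -/
noncomputable def chirpFourier (c : ℝ) : L2R ≃ₗᵢ[ℂ] L2R :=
  (unimodMul (chirp c) (continuous_chirp c).measurable (norm_chirp c)).trans
    (Lp.fourierTransformₗᵢ ℝ ℂ)

lemma coeFn_schwartzIncl (ψ : 𝓢(ℝ, ℂ)) : (schwartzIncl ψ : ℝ → ℂ) =ᵐ[volume] ψ :=
  SchwartzMap.coeFn_toLp ψ 2 volume

lemma fourier_schwartzIncl (ψ : 𝓢(ℝ, ℂ)) :
    Lp.fourierTransformₗᵢ ℝ ℂ (schwartzIncl ψ) = schwartzIncl (𝓕 ψ) :=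
  SchwartzMap.toLp_fourier_eq ψ

lemma chirpFourier_eq {c : ℝ} {F : L2R} {ψ : 𝓢(ℝ, ℂ)}
    (h : (fun x => chirp c x * F x) =ᵐ[volume] ψ) : chirpFourier c F = schwartzIncl (𝓕 ψ) := by
  rw [← fourier_schwartzIncl]
  change Lp.fourierTransformₗᵢ ℝ ℂ (unimodMul _ _ _ F) = _
  congr 1
  apply Lp.ext
  exact (coeFn_unimodMul _ _ _ F).trans (h.trans (coeFn_schwartzIncl ψ).symm)

/-- The action of `chirpFourier c` on Schwartz functions. -/
noncomputable def chirpFourierSchwartz (c : ℝ) (ψ : 𝓢(ℝ, ℂ)) : 𝓢(ℝ, ℂ) :=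
  𝓕 (SchwartzMap.smulLeftCLM ℂ (chirp c) ψ)

lemma chirpFourier_schwartzIncl (c : ℝ) (ψ : 𝓢(ℝ, ℂ)) :
    chirpFourier c (schwartzIncl ψ) = schwartzIncl (chirpFourierSchwartz c ψ) := by
  apply chirpFourier_eq
  filter_upwards [coeFn_schwartzIncl ψ] with x hx
  rw [hx, SchwartzMap.smulLeftCLM_apply_apply (hasTemperateGrowth_chirp c), smul_eq_mul]

lemma chirpFourierSchwartz_surjective (c : ℝ) : Function.Surjective (chirpFourierSchwartz c) := by
  intro χ
  refine ⟨SchwartzMap.smulLeftCLM ℂ (chirp (-c)) (𝓕⁻ χ), ?_⟩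
  have : SchwartzMap.smulLeftCLM ℂ (chirp c) (SchwartzMap.smulLeftCLM ℂ (chirp (-c)) (𝓕⁻ χ))
      = 𝓕⁻ χ := by
    ext x
    rw [SchwartzMap.smulLeftCLM_apply_apply (hasTemperateGrowth_chirp c),
      SchwartzMap.smulLeftCLM_apply_apply (hasTemperateGrowth_chirp (-c)), smul_eq_mul,
      smul_eq_mul, ← mul_assoc, mul_comm (chirp c x), chirp_neg_mul, one_mul]
  rw [chirpFourierSchwartz, this, FourierTransform.fourier_fourierInv_eq]

lemma chirpFourierSchwartz_heisenberg (c β : ℝ) (ψ : 𝓢(ℝ, ℂ)) (ξ : ℝ) :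
    chirpFourierSchwartz c (heisenbergSchwartz (β * c) β ψ) ξ
      = ((β * ξ : ℝ) : ℂ) * chirpFourierSchwartz c ψ ξ := by
  set g : 𝓢(ℝ, ℂ) := SchwartzMap.smulLeftCLM ℂ (chirp c) ψ with hg
  have hgx : ∀ x, g x = chirp c x * ψ x := fun x => by
    rw [hg, SchwartzMap.smulLeftCLM_apply_apply (hasTemperateGrowth_chirp c), smul_eq_mul]
  have hgf : (g : ℝ → ℂ) = fun x => chirp c x * ψ x := funext hgx
  have hder : ∀ x, deriv g x = 2 * Real.pi * Complex.I * c * x * chirp c x * ψ x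
      + chirp c x * deriv ψ x := by
    intro x
    rw [hgf]
    exact ((hasDerivAt_chirp c x).mul ψ.differentiableAt.hasDerivAt).deriv
  have hpi : (2 * Real.pi * Complex.I : ℂ) ≠ 0 := Complex.two_pi_I_ne_zero
  have h1 : SchwartzMap.smulLeftCLM ℂ (chirp c) (heisenbergSchwartz (β * c) β ψ)
      = ((β : ℂ) * (1 / (2 * Real.pi * Complex.I))) • SchwartzMap.derivCLM ℂ ℂ g := by
    ext x
    rw [SchwartzMap.smulLeftCLM_apply_apply (hasTemperateGrowth_chirp c),
      heisenbergSchwartz_apply, _root_.smul_apply, SchwartzMap.derivCLM_apply, hder,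
      smul_eq_mul, smul_eq_mul]
    push_cast
    field_simp
  have h2 : 𝓕 (SchwartzMap.derivCLM ℂ ℂ g) ξ = (2 * Real.pi * Complex.I * ξ) * 𝓕 g ξ := by
    have := congrFun (Real.fourier_deriv (f := (g : ℝ → ℂ)) g.integrable g.differentiable
      (SchwartzMap.derivCLM ℂ ℂ g).integrable) ξ
    rw [SchwartzMap.fourier_coe, SchwartzMap.fourier_coe]
    have e : ⇑(SchwartzMap.derivCLM ℂ ℂ g) = deriv g := by
      funext x
      rw [SchwartzMap.derivCLM_apply]
    rw [e]
    simpa using this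
  rw [chirpFourierSchwartz, chirpFourierSchwartz, h1, ← hg, FourierTransform.fourier_smul,
    _root_.smul_apply, h2, smul_eq_mul]
  push_cast
  field_simp

/-! ### The self-adjoint operators `α u + β p` -/

lemma mem_adjoint_graph {H : Type} [NormedAddCommGroup H] [InnerProductSpace ℂ H]
    [CompleteSpace H] {T : H →ₗ.[ℂ] H} (hT : Dense (T.domain : Set H)) {x y : H} :
    (x, y) ∈ T.adjoint.graph ↔ ∀ g : T.domain, ⟪y, (g : H)⟫ = ⟪x, T g⟫ := by
  rw [LinearPMap.mem_graph_iff]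
  constructor
  · rintro ⟨z, rfl, rfl⟩ g
    exact LinearPMap.adjoint_isFormalAdjoint hT z g
  · intro h
    exact ⟨⟨x, LinearPMap.mem_adjoint_domain_of_exists x ⟨y, h⟩⟩, rfl,
      LinearPMap.adjoint_apply_eq hT _ h⟩

lemma inner_schwartzIncl (F : L2R) (χ : 𝓢(ℝ, ℂ)) :
    ⟪F, schwartzIncl χ⟫ = ∫ x, starRingEnd ℂ (F x) * χ x := by
  rw [inner_eq_integral (LinearIsometryEquiv.refl ℂ L2R)]
  apply integral_congr_ae
  filter_upwards [coeFn_schwartzIncl χ] with x hx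
  simp only [LinearIsometryEquiv.coe_refl, id_eq, hx]

/-- Multiplication by a continuous real function on the Schwartz functions has the maximal
multiplication operator as its adjoint. -/
lemma ae_eq_mul_iff_inner {F G : L2R} {φ : ℝ → ℝ} (hφ : Continuous φ) {M : 𝓢(ℝ, ℂ) → 𝓢(ℝ, ℂ)}
    (hM : ∀ χ x, M χ x = φ x * χ x) :
    (∀ χ, ⟪G, schwartzIncl χ⟫ = ⟪F, schwartzIncl (M χ)⟫) ↔
      (G : ℝ → ℂ) =ᵐ[volume] fun x => φ x * F x := by
  simp only [inner_schwartzIncl, hM]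
  constructor
  · intro h
    have hF : LocallyIntegrable (fun x => starRingEnd ℂ (F x)) volume :=
      ((Lp.memLp F).star.locallyIntegrable (by norm_num))
    have hG : LocallyIntegrable (fun x => starRingEnd ℂ (G x)) volume :=
      ((Lp.memLp G).star.locallyIntegrable (by norm_num))
    have hφF : LocallyIntegrable (fun x => (φ x : ℂ) * starRingEnd ℂ (F x)) volume := by
      have := LocallyIntegrableOn.continuousOn_mul (hF.locallyIntegrableOn Set.univ)
        (Complex.continuous_ofReal.comp hφ).continuousOn isOpen_univ.isLocallyClosed
      exact locallyIntegrableOn_univ.mp this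
    have key := ae_eq_zero_of_integral_contDiff_smul_eq_zero (hG.sub hφF) (by
      intro g hg hgc
      have hg₁ : HasCompactSupport (Complex.ofRealCLM ∘ g) := hgc.comp_left rfl
      have hg₂ : ContDiff ℝ ∞ (Complex.ofRealCLM ∘ g) := by fun_prop
      have := h (hg₁.toSchwartzMap hg₂)
      have i1 := hG.integrable_smul_left_of_hasCompactSupport hg.continuous hgc
      have i2 := hφF.integrable_smul_left_of_hasCompactSupport hg.continuous hgc
      simp only [Pi.sub_apply, smul_sub]
      rw [integral_sub i1 i2, sub_eq_zero]
      convert this using 2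
      · funext x
        rw [Complex.real_smul, mul_comm]
        rfl
      · funext x
        rw [Complex.real_smul]
        change (g x : ℂ) * _ = _ * (_ * (g x : ℂ))
        ring)
    filter_upwards [key] with x hx
    rw [Pi.sub_apply, sub_eq_zero] at hx
    have := congrArg (starRingEnd ℂ) hx
    simpa using this
  · intro h χ
    apply integral_congr_ae
    filter_upwards [h] with x hx
    rw [hx, map_mul, Complex.conj_ofReal]
    ring

/-- A unitary that preserves the Schwartz space and turns `α u + β p` into multiplication by a
continuous function there does so for the self-adjoint operator, too. -/
lemma heisenberg_eq_diagOp {α β : ℝ} {W : L2R ≃ₗᵢ[ℂ] L2R} {S : 𝓢(ℝ, ℂ) → 𝓢(ℝ, ℂ)} {φ : ℝ → ℝ}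
    (hφ : Continuous φ) (hS : Function.Surjective S)
    (hW : ∀ ψ, W (schwartzIncl ψ) = schwartzIncl (S ψ))
    (hSφ : ∀ ψ x, S (heisenbergSchwartz α β ψ) x = φ x * S ψ x) :
    heisenberg α β = diagOp W (fun x => (φ x : ℂ)) := by
  have hd : Dense ((heisenbergCore α β).domain : Set L2R) := by
    have := SchwartzMap.denseRange_toLpCLM (E := ℝ) (F := ℂ) (p := 2) (μ := volume) (by norm_num)
    exact this
  apply LinearPMap.eq_of_eq_graph
  ext ⟨x, y⟩
  obtain ⟨R, hR⟩ := hS.hasRightInverse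
  rw [heisenberg, mem_adjoint_graph hd, mem_diagOp_graph,
    ← ae_eq_mul_iff_inner hφ (M := fun χ => S (heisenbergSchwartz α β (R χ)))
      (fun χ x => by rw [hSφ, hR])]
  have hm : ∀ ψ, schwartzIncl ψ ∈ (heisenbergCore α β).domain := fun ψ => ⟨ψ, rfl⟩
  have hcore : ∀ ψ (h : schwartzIncl ψ ∈ (heisenbergCore α β).domain),
      heisenbergCore α β ⟨schwartzIncl ψ, h⟩ = schwartzIncl (heisenbergSchwartz α β ψ) := by
    intro ψ h
    change schwartzIncl (heisenbergSchwartz α β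
      ((LinearEquiv.ofInjective schwartzIncl schwartzIncl_injective).symm ⟨schwartzIncl ψ, h⟩)) = _
    congr 2
    rw [LinearEquiv.symm_apply_eq]
    rfl
  constructor
  · intro h χ
    have : ⟪y, schwartzIncl (R χ)⟫ = ⟪x, heisenbergCore α β ⟨schwartzIncl (R χ), hm _⟩⟫ :=
      h ⟨schwartzIncl (R χ), hm _⟩
    rw [hcore] at this
    rw [← W.inner_map_map, ← W.inner_map_map x, hW, hW, hR] at this
    exact this
  · rintro h ⟨_, ψ, rfl⟩
    change ⟪y, schwartzIncl ψ⟫ = ⟪x, heisenbergCore α β ⟨schwartzIncl ψ, hm ψ⟩⟫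
    rw [hcore, ← W.inner_map_map, ← W.inner_map_map x, hW, hW]
    rw [h (S ψ)]
    congr 2
    ext x
    rw [hSφ, hSφ, hR]

lemma heisenberg_eq_chirpFourier (c β : ℝ) :
    heisenberg (β * c) β = diagOp (chirpFourier c) (fun ξ => ((β * ξ : ℝ) : ℂ)) :=
  heisenberg_eq_diagOp (φ := fun ξ => β * ξ) (by fun_prop) (chirpFourierSchwartz_surjective c)
    (chirpFourier_schwartzIncl c) (chirpFourierSchwartz_heisenberg c β)

lemma heisenberg_eq_mul (α : ℝ) :
    heisenberg α 0 = diagOp (LinearIsometryEquiv.refl ℂ L2R) (fun x => ((α * x : ℝ) : ℂ)) :=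
  heisenberg_eq_diagOp (φ := fun x => α * x) (S := id) (by fun_prop) Function.surjective_id
    (fun _ => rfl) (fun ψ x => by
      rw [id, id, heisenbergSchwartz_apply]
      push_cast
      ring)

/-! ### The space of entire Gaussian functions -/

/-- The span of the entire functions `exp (-a z² + B z) P(z)` with `a > 0`. Its restriction to the
real line is `gaussianSpace`, see `gaussIncl`. -/
noncomputable def gaussFnSpace : Submodule ℂ (ℂ → ℂ) :=
  Submodule.span ℂ {F | ∃ (a : ℝ) (B : ℂ) (P : ℂ[X]), 0 < a ∧ F = gaussFn a B P}

lemma gaussFn_mem {a : ℝ} (ha : 0 < a) (B : ℂ) (P : ℂ[X]) : gaussFn a B P ∈ gaussFnSpace :=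
  Submodule.subset_span ⟨a, B, P, ha, rfl⟩

lemma gaussFnSpace_induction {p : (F : ℂ → ℂ) → F ∈ gaussFnSpace → Prop}
    (gauss : ∀ (a : ℝ) (B : ℂ) (P : ℂ[X]) (ha : 0 < a), p (gaussFn a B P) (gaussFn_mem ha B P))
    (zero : p 0 gaussFnSpace.zero_mem)
    (add : ∀ F G (hF : F ∈ gaussFnSpace) (hG : G ∈ gaussFnSpace), p F hF → p G hG →
      p (F + G) (gaussFnSpace.add_mem hF hG))
    (smul : ∀ (c : ℂ) F (hF : F ∈ gaussFnSpace), p F hF →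
      p (c • F) (gaussFnSpace.smul_mem c hF))
    {F : ℂ → ℂ} (hF : F ∈ gaussFnSpace) : p F hF := by
  refine Submodule.span_induction (fun F h => ?_) zero (fun F G hF hG h h' => add F G hF hG h h')
    (fun c F hF h => smul c F hF h) hF
  obtain ⟨a, B, P, ha, rfl⟩ := h
  exact gauss a B P ha

lemma memLp_gaussFnSpace {F : ℂ → ℂ} (hF : F ∈ gaussFnSpace) :
    MemLp (fun x : ℝ => F x) 2 volume := by
  induction hF using gaussFnSpace_induction with
  | gauss a B P ha =>
    exact (gaussSchwartz (A := (a : ℂ)) (by simpa using ha) B P).memLp 2 volume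
  | zero => exact MemLp.zero'
  | add F G hF hG h h' => exact h.add h'
  | smul c F hF h => exact h.const_smul c

/-- The restriction of entire Gaussian functions to the real line, as elements of `L²(ℝ)`. -/
noncomputable def gaussToL2 : gaussFnSpace →ₗ[ℂ] L2R where
  toFun F := (memLp_gaussFnSpace F.2).toLp _
  map_add' _ _ := rfl
  map_smul' _ _ := rfl

lemma coeFn_gaussToL2 (F : gaussFnSpace) :
    (gaussToL2 F : ℝ → ℂ) =ᵐ[volume] fun x : ℝ => (F : ℂ → ℂ) x :=
  MemLp.coeFn_toLp (memLp_gaussFnSpace F.2)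

lemma range_gaussToL2 : LinearMap.range gaussToL2 = gaussianSpace := by
  apply le_antisymm
  · rintro _ ⟨⟨F, hF⟩, rfl⟩
    induction hF using gaussFnSpace_induction with
    | gauss a B P ha =>
      exact Submodule.subset_span ⟨a, B, P, ha, coeFn_gaussToL2 _⟩
    | zero => exact gaussianSpace.zero_mem
    | add F G hF hG h h' => exact gaussianSpace.add_mem h h'
    | smul c F hF h => exact gaussianSpace.smul_mem c h
  · refine Submodule.span_le.mpr ?_
    rintro h ⟨a, B, P, ha, hh⟩
    exact ⟨⟨_, gaussFn_mem ha B P⟩, Lp.ext ((coeFn_gaussToL2 _).trans hh.symm)⟩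

/-- The restriction to the real line, as a map onto `gaussianSpace`. -/
noncomputable def gaussIncl : gaussFnSpace →ₗ[ℂ] gaussianSpace :=
  gaussToL2.codRestrict gaussianSpace fun F => range_gaussToL2 ▸ ⟨F, rfl⟩

@[simp] lemma coe_gaussIncl (F : gaussFnSpace) : (gaussIncl F : L2R) = gaussToL2 F := rfl

lemma gaussIncl_surjective : Function.Surjective gaussIncl := by
  rintro ⟨v, hv⟩
  rw [← range_gaussToL2] at hv
  obtain ⟨F, rfl⟩ := hv
  exact ⟨F, rfl⟩

/-- The action `F(z) ↦ exp (2πbαz - πib²αβ) F(z - ibβ)` of `exp (2πb (α u + β p))` on entire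
functions. -/
noncomputable def weylShift (b α β : ℝ) : (ℂ → ℂ) →ₗ[ℂ] (ℂ → ℂ) where
  toFun F z := Complex.exp (2 * Real.pi * b * α * z - Complex.I * Real.pi * b ^ 2 * α * β)
    * F (z - Complex.I * (b * β : ℝ))
  map_add' F G := by
    funext z
    simp only [Pi.add_apply, mul_add]
  map_smul' c F := by
    funext z
    simp only [Pi.smul_apply, smul_eq_mul, RingHom.id_apply]
    ring

lemma weylShift_apply (b α β : ℝ) (F : ℂ → ℂ) (z : ℂ) :
    weylShift b α β F z
      = Complex.exp (2 * Real.pi * b * α * z - Complex.I * Real.pi * b ^ 2 * α * β)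
        * F (z - Complex.I * (b * β : ℝ)) := rfl

lemma gaussFn_sub (A B : ℂ) (P : ℂ[X]) (s z : ℂ) :
    gaussFn A B P (z - s) = Complex.exp (-A * s ^ 2 - B * s)
      * gaussFn A (B + 2 * A * s) (P.comp (X - C s)) z := by
  have := gaussFn_add A B P z (-s)
  rw [sub_eq_add_neg, this]
  congr 2
  · ring
  · ring
  · rw [C_neg, sub_eq_add_neg]

lemma exp_mul_gaussFn (A B : ℂ) (P : ℂ[X]) (k z : ℂ) :
    Complex.exp (k * z) * gaussFn A B P z = gaussFn A (B + k) P z := by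
  rw [gaussFn, gaussFn, ← mul_assoc, ← Complex.exp_add]
  congr 2
  ring

lemma weylShift_mem (b α β : ℝ) {F : ℂ → ℂ} (hF : F ∈ gaussFnSpace) :
    weylShift b α β F ∈ gaussFnSpace := by
  induction hF using gaussFnSpace_induction with
  | gauss a B P ha =>
    set s : ℂ := Complex.I * (b * β : ℝ)
    have : weylShift b α β (gaussFn a B P)
        = (Complex.exp (- (Complex.I * Real.pi * b ^ 2 * α * β))
            * Complex.exp (-a * s ^ 2 - B * s))
          • gaussFn a (B + 2 * a * s + 2 * Real.pi * b * α) (P.comp (X - C s)) := by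
      funext z
      rw [weylShift_apply, gaussFn_sub, Pi.smul_apply, smul_eq_mul,
        ← exp_mul_gaussFn _ (B + 2 * a * s) _ (2 * Real.pi * b * α) z,
        sub_eq_add_neg (2 * Real.pi * b * α * z), Complex.exp_add]
      ring
    rw [this]
    exact gaussFnSpace.smul_mem _ (gaussFn_mem ha _ _)
  | zero => rw [map_zero]; exact gaussFnSpace.zero_mem
  | add F G hF hG h h' => rw [map_add]; exact gaussFnSpace.add_mem h h'
  | smul c F hF h => rw [map_smul]; exact gaussFnSpace.smul_mem c h

/-- `weylShift` on the entire Gaussian functions. -/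
noncomputable def weylEnd (b α β : ℝ) : Module.End ℂ gaussFnSpace :=
  (weylShift b α β).restrict fun _ hF => weylShift_mem b α β hF

@[simp] lemma coe_weylEnd (b α β : ℝ) (F : gaussFnSpace) :
    (weylEnd b α β F : ℂ → ℂ) = weylShift b α β F := rfl

/-! ### The exponentials `exp (2πb (α u + β p))` -/

/-- The operator `exp (2πbβ (c u + p))`. -/
noncomputable def weylExp (b c β : ℝ) : L2R →ₗ.[ℂ] L2R :=
  diagOp (chirpFourier c) (fun ξ => (Real.exp (2 * Real.pi * b * (β * ξ)) : ℂ))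

/-- The operator `exp (2πbαu)`. -/
noncomputable def mulExp (b α : ℝ) : L2R →ₗ.[ℂ] L2R :=
  diagOp (LinearIsometryEquiv.refl ℂ L2R) (fun x => (Real.exp (2 * Real.pi * b * (α * x)) : ℂ))

lemma isWeylExp_weylExp (b c β : ℝ) : IsWeylExp b (β * c) β (weylExp b c β) := by
  rw [IsWeylExp, heisenberg_eq_chirpFourier]
  exact isBorelFun_diagOp _ (by fun_prop) _

lemma isWeylExp_mulExp (b α : ℝ) : IsWeylExp b α 0 (mulExp b α) := by
  rw [IsWeylExp, heisenberg_eq_mul]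
  exact isBorelFun_diagOp _ (by fun_prop) _

/-- `chirpFourier c F` is given by the Fourier integral if `F` times the chirp is a Gaussian function
with its argument shifted by a complex number `s`: such a function is again a Schwartz function. -/
lemma chirpFourier_gauss (c : ℝ) {a : ℝ} (ha : 0 < a) (B : ℂ) (P : ℂ[X]) (s : ℂ) {F : L2R}
    (hF : (fun x => chirp c x * F x) =ᵐ[volume]
      fun x : ℝ => gaussFn (a - Complex.I * Real.pi * c) B P (x - s)) :
    (chirpFourier c F : ℝ → ℂ) =ᵐ[volume]
      𝓕 (fun x : ℝ => gaussFn (a - Complex.I * Real.pi * c) B P (x - s)) := by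
  set A : ℂ := a - Complex.I * Real.pi * c with hA
  have hA0 : 0 < A.re := by simpa [hA] using ha
  set ψ : 𝓢(ℝ, ℂ) := Complex.exp (-A * s ^ 2 - B * s)
    • gaussSchwartz hA0 (B + 2 * A * s) (P.comp (X - C s)) with hψ
  have e : (ψ : ℝ → ℂ) = fun x : ℝ => gaussFn A B P (x - s) := by
    funext x
    rw [hψ, _root_.smul_apply, gaussSchwartz_apply, smul_eq_mul, gaussFn_sub]
  rw [← e] at hF ⊢
  rw [chirpFourier_eq hF, ← SchwartzMap.fourier_coe]
  exact coeFn_schwartzIncl _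

lemma chirp_mul_gaussFn (c : ℝ) (a : ℝ) (B : ℂ) (P : ℂ[X]) (x : ℝ) :
    chirp c x * gaussFn a B P x = gaussFn (a - Complex.I * Real.pi * c) B P x := by
  rw [chirp_eq, gaussFn, gaussFn, ← mul_assoc, ← Complex.exp_add]
  congr 2
  ring

/-- `exp (2πb (α u + β p))` acts on Gaussian functions by `weylShift`: the imaginary shift of the
argument becomes multiplication by `exp (2πbβξ)` after the Fourier transform. -/
lemma mem_weylExp_graph (b c β : ℝ) (F : gaussFnSpace) :
    (gaussToL2 F, gaussToL2 (weylEnd b (β * c) β F)) ∈ (weylExp b c β).graph := by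
  obtain ⟨F, hF⟩ := F
  induction hF using gaussFnSpace_induction with
  | gauss a B P ha =>
    have h1 := chirpFourier_gauss c ha B P 0 (F := gaussToL2 ⟨_, gaussFn_mem ha B P⟩) (by
      filter_upwards [coeFn_gaussToL2 ⟨_, gaussFn_mem ha B P⟩] with x hx
      rw [hx, sub_zero, chirp_mul_gaussFn])
    have h2 := chirpFourier_gauss c ha B P (Complex.I * (b * β : ℝ))
      (F := gaussToL2 (weylEnd b (β * c) β ⟨_, gaussFn_mem ha B P⟩)) (by
      filter_upwards [coeFn_gaussToL2 (weylEnd b (β * c) β ⟨_, gaussFn_mem ha B P⟩)] with x hx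
      rw [hx, coe_weylEnd, weylShift_apply, chirp_eq]
      simp only [gaussFn]
      rw [← mul_assoc, ← mul_assoc, ← Complex.exp_add, ← Complex.exp_add]
      congr 2
      push_cast
      linear_combination (-Complex.I * Real.pi * c * b ^ 2 * β ^ 2) * Complex.I_sq
        + 2 * Real.pi * c * b * β * x * Complex.I_sq)
    have hA0 : 0 < ((a : ℂ) - Complex.I * Real.pi * c).re := by simpa using ha
    rw [weylExp, mem_diagOp_graph]
    filter_upwards [h1, h2] with ξ e1 e2
    simp only [sub_zero] at e1
    rw [e1, e2, fourier_gaussFn_sub hA0]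
    congr 1
    push_cast
    congr 1
    ring
  | zero =>
    have h := (weylExp b c β).graph.zero_mem
    rw [← Prod.mk_zero_zero, ← map_zero gaussToL2] at h
    nth_rw 2 [← map_zero (weylEnd b (β * c) β)] at h
    exact h
  | add F G hF hG h h' =>
    have h2 := (weylExp b c β).graph.add_mem h h'
    rw [Prod.mk_add_mk, ← map_add, ← map_add, ← map_add] at h2
    exact h2
  | smul k F hF h =>
    have h2 := (weylExp b c β).graph.smul_mem k h
    rw [Prod.smul_mk, ← map_smul, ← map_smul, ← map_smul] at h2
    exact h2

lemma mem_mulExp_graph (b α : ℝ) (F : gaussFnSpace) :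
    (gaussToL2 F, gaussToL2 (weylEnd b α 0 F)) ∈ (mulExp b α).graph := by
  rw [mulExp, mem_diagOp_graph]
  filter_upwards [coeFn_gaussToL2 F, coeFn_gaussToL2 (weylEnd b α 0 F)] with x h1 h2
  simp only [LinearIsometryEquiv.coe_refl, id_eq]
  rw [h1, h2, coe_weylEnd, weylShift_apply]
  push_cast
  simp only [mul_zero, sub_zero]
  congr 2
  ring

/-! ### Gaussian functions as a core -/

lemma gaussianSpace_le_of_graph {T : L2R →ₗ.[ℂ] L2R} {S : Module.End ℂ gaussFnSpace}
    (hT : ∀ F, (gaussToL2 F, gaussToL2 (S F)) ∈ T.graph) : gaussianSpace ≤ T.domain := by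
  intro v hv
  rw [← range_gaussToL2] at hv
  obtain ⟨F, rfl⟩ := hv
  exact LinearPMap.mem_domain_of_mem_graph (hT F)

/-- A function in `L²(ℝ)` that is orthogonal to all modulations of a function `u` without zeros
vanishes. -/
lemma eq_zero_of_integral_modulation {h : L2R} {u : ℝ → ℂ}
    (hi : Integrable (fun x => starRingEnd ℂ (h x) * u x)) (hu : ∀ x, u x ≠ 0)
    (h0 : ∀ s : ℝ, ∫ x : ℝ, Complex.exp (Complex.I * s * x) * (starRingEnd ℂ (h x) * u x) = 0) :
    h = 0 := by
  rw [Lp.eq_zero_iff_ae_eq_zero]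
  filter_upwards [ae_eq_zero_of_integral_exp_mul_eq_zero hi h0] with x hx
  simpa [hu x] using hx

/-- A subspace that contains, in the diagonal representation, all modulations of a function without
zeros is a core of a positive multiplication operator. -/
lemma hasCore_of_modulations {W : L2R ≃ₗᵢ[ℂ] L2R} {φ : ℝ → ℝ} (hφ : Measurable φ)
    (h0 : ∀ x, 0 < φ x) {S : Submodule ℂ L2R} (hS : S ≤ (diagOp W (fun x => (φ x : ℂ))).domain)
    (g : ℝ → L2R) (hg : ∀ s, g s ∈ S) (u : ℝ → ℂ) (hu : ∀ x, u x ≠ 0) (k : ℝ → ℂ)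
    (hk : ∀ s, k s ≠ 0)
    (hgu : ∀ s : ℝ, (W (g s) : ℝ → ℂ) =ᵐ[volume]
      fun x : ℝ => k s * (Complex.exp (Complex.I * s * x) * u x)) :
    (diagOp W (fun x => (φ x : ℂ))).HasCore S := by
  refine (nonnegResolvent_diagOp hφ fun x => (h0 x).le).hasCore hS fun h hh => ?_
  have hmul : ∀ s : ℝ, (W (g s + diagOp W (fun x => (φ x : ℂ)) ⟨g s, hS (hg s)⟩) : ℝ → ℂ)
      =ᵐ[volume] fun x : ℝ => k s * (Complex.exp (Complex.I * s * x) * ((1 + φ x) * u x)) := by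
    intro s
    rw [map_add]
    filter_upwards [hgu s,
      Lp.coeFn_add (W (g s)) (W (diagOp W (fun x => (φ x : ℂ)) ⟨g s, hS (hg s)⟩)),
      diagOp_apply_ae (W := W) (φ := fun x => (φ x : ℂ)) ⟨g s, hS (hg s)⟩] with x h1 h2 h3
    rw [h2, Pi.add_apply, h3, h1]
    ring
  have hu' : ∀ x, (1 + (φ x : ℂ)) * u x ≠ 0 := fun x => by
    refine mul_ne_zero ?_ (hu x)
    have : 1 + φ x ≠ 0 := (add_pos one_pos (h0 x)).ne'
    exact_mod_cast this
  have hWh : W h = 0 := by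
    refine eq_zero_of_integral_modulation (u := fun x => (1 + (φ x : ℂ)) * u x) ?_ hu' fun s => ?_
    · have := (L2.integrable_inner (𝕜 := ℂ) (W h)
        (W (g 0 + diagOp W (fun x => (φ x : ℂ)) ⟨g 0, hS (hg 0)⟩))).const_mul (k 0)⁻¹
      refine this.congr ?_
      filter_upwards [hmul 0] with x hx
      rw [hx, RCLike.inner_apply]
      simp only [Complex.ofReal_zero, mul_zero, zero_mul, Complex.exp_zero, one_mul]
      field_simp [hk 0]
    · have := hh (g s) (hg s)
      rw [inner_eq_integral W] at this
      have h2 : ∫ x : ℝ, k s * (Complex.exp (Complex.I * s * x)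
          * (starRingEnd ℂ (W h x) * ((1 + (φ x : ℂ)) * u x))) = 0 := by
        rw [← this]
        apply integral_congr_ae
        filter_upwards [hmul s] with x hx
        rw [hx]
        ring
      rw [integral_const_mul] at h2
      exact (mul_eq_zero.mp h2).resolve_left (hk s)
  simpa using hWh

lemma hasCore_weylExp (b c β : ℝ) : (weylExp b c β).HasCore gaussianSpace := by
  set A : ℂ := (1 : ℝ) - Complex.I * Real.pi * c with hA
  have hA1 : 0 < A.re := by simp [hA]
  have hA0 : A ≠ 0 := by intro h; simp [h] at hA1
  have hpi : (Real.pi : ℂ) ≠ 0 := by exact_mod_cast Real.pi_ne_zero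
  refine hasCore_of_modulations (by fun_prop) (fun x => Real.exp_pos _)
    (gaussianSpace_le_of_graph (mem_weylExp_graph b c β))
    -- the linear coefficient `-As/π` in the exponent is the one whose Fourier transform carries the
    -- factor `exp (isξ)`
    (fun s => gaussToL2 ⟨_, gaussFn_mem one_pos (-(A * s / Real.pi)) 1⟩)
    (fun s => (gaussIncl _).2)
    (fun ξ => (Real.pi / A) ^ (1 / 2 : ℂ) * Complex.exp (-(Real.pi ^ 2 * ξ ^ 2 / A))) ?_
    (fun s => Complex.exp (A * s ^ 2 / (4 * Real.pi ^ 2))) (fun s => Complex.exp_ne_zero _) ?_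
  · intro x
    refine mul_ne_zero ?_ (Complex.exp_ne_zero _)
    rw [Complex.cpow_ne_zero_iff]
    left
    exact div_ne_zero hpi hA0
  · intro s
    have h1 := chirpFourier_gauss c one_pos (-(A * s / Real.pi)) 1 0
      (F := gaussToL2 ⟨_, gaussFn_mem one_pos (-(A * s / Real.pi)) 1⟩) (by
      filter_upwards [coeFn_gaussToL2 ⟨_, gaussFn_mem one_pos (-(A * s / Real.pi)) 1⟩] with x hx
      rw [hx, sub_zero, chirp_mul_gaussFn])
    filter_upwards [h1] with ξ e1
    simp only [sub_zero] at e1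
    rw [e1, fourier_gaussFn_one hA1, mul_left_comm (Complex.exp (Complex.I * s * ξ)),
      mul_left_comm (Complex.exp (A * s ^ 2 / (4 * Real.pi ^ 2))), ← Complex.exp_add,
      ← Complex.exp_add]
    congr 2
    field_simp
    linear_combination (4 * Real.pi ^ 4 * ξ ^ 2 : ℂ) * Complex.I_sq

/-- The Gaussian `exp (-u² + isu)` in `gaussianSpace`. -/
noncomputable def modulatedGaussian (s : ℝ) : L2R :=
  gaussToL2 ⟨_, gaussFn_mem one_pos (Complex.I * s) 1⟩

lemma modulatedGaussian_mem (s : ℝ) : modulatedGaussian s ∈ gaussianSpace := (gaussIncl _).2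

lemma coeFn_modulatedGaussian (s : ℝ) : (modulatedGaussian s : ℝ → ℂ) =ᵐ[volume]
    fun x : ℝ => Complex.exp (Complex.I * s * x) * Complex.exp (-(x : ℂ) ^ 2) := by
  filter_upwards [coeFn_gaussToL2 ⟨_, gaussFn_mem one_pos (Complex.I * s) 1⟩] with x hx
  rw [modulatedGaussian, hx, gaussFn, eval_one, mul_one, ← Complex.exp_add]
  congr 1
  push_cast
  ring

lemma hasCore_mulExp (b α : ℝ) : (mulExp b α).HasCore gaussianSpace := by
  refine hasCore_of_modulations (by fun_prop) (fun x => Real.exp_pos _)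
    (gaussianSpace_le_of_graph (mem_mulExp_graph b α)) modulatedGaussian
    modulatedGaussian_mem
    (fun x => Complex.exp (-(x : ℂ) ^ 2)) (fun x => Complex.exp_ne_zero _) (fun _ => 1)
    (fun _ => one_ne_zero) fun s => ?_
  filter_upwards [coeFn_modulatedGaussian s] with x hx
  rw [one_mul]
  exact hx

lemma dense_gaussianSpace : Dense (gaussianSpace : Set L2R) := by
  rw [Submodule.dense_iff_topologicalClosure_eq_top,
    Submodule.topologicalClosure_eq_top_iff, Submodule.eq_bot_iff]
  intro h hh
  rw [Submodule.mem_orthogonal'] at hh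
  refine eq_zero_of_integral_modulation (u := fun x => Complex.exp (-(x : ℂ) ^ 2)) ?_
    (fun x => Complex.exp_ne_zero _) fun s => ?_
  · refine (L2.integrable_inner (𝕜 := ℂ) h (modulatedGaussian 0)).congr ?_
    filter_upwards [coeFn_modulatedGaussian 0] with x hx
    rw [hx, RCLike.inner_apply]
    simp [mul_comm]
  · rw [← hh _ (modulatedGaussian_mem s), inner_eq_integral (LinearIsometryEquiv.refl ℂ L2R)]
    apply integral_congr_ae
    filter_upwards [coeFn_modulatedGaussian s] with x hx
    simp only [LinearIsometryEquiv.coe_refl, id_eq]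
    rw [hx]
    ring

/-! ### The representation -/

lemma differentiable_gaussFnSpace {F : ℂ → ℂ} (hF : F ∈ gaussFnSpace) : Differentiable ℂ F := by
  induction hF using gaussFnSpace_induction with
  | gauss a B P ha => exact fun z => (hasDerivAt_gaussFn a B P z).differentiableAt
  | zero => exact differentiable_const 0
  | add F G hF hG h h' => exact h.add h'
  | smul c F hF h => exact h.const_smul c

/-- An entire Gaussian function is determined by its class in `L²(ℝ)`. -/
lemma gaussIncl_injective : Function.Injective gaussIncl := by
  rw [← LinearMap.ker_eq_bot, LinearMap.ker_eq_bot']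
  rintro ⟨F, hF⟩ h
  have hd := differentiable_gaussFnSpace hF
  have h1 : gaussToL2 ⟨F, hF⟩ = 0 := congrArg Subtype.val h
  have h2 : (fun x : ℝ => F x) =ᵐ[volume] fun _ => 0 := by
    filter_upwards [coeFn_gaussToL2 ⟨F, hF⟩, (Lp.eq_zero_iff_ae_eq_zero).mp h1] with x e1 e2
    rw [← e1, e2]
    rfl
  have h3 : (fun x : ℝ => F x) = fun _ => 0 :=
    (Continuous.ae_eq_iff_eq volume (hd.continuous.comp Complex.continuous_ofReal)
      continuous_const).mp h2
  have h4 : Filter.Tendsto (fun x : ℝ => (x : ℂ)) (nhdsWithin 0 {0}ᶜ) (nhdsWithin 0 {0}ᶜ) := by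
    refine tendsto_nhdsWithin_of_tendsto_nhds_of_eventually_within _ ?_ ?_
    · exact (Complex.continuous_ofReal.tendsto' 0 0 rfl).mono_left nhdsWithin_le_nhds
    · filter_upwards [self_mem_nhdsWithin] with x hx
      simpa using hx
  have h5 : F = fun _ => 0 := AnalyticOnNhd.eq_of_frequently_eq (z₀ := 0)
    (fun z _ => hd.analyticAt z) analyticOnNhd_const
    (h4.frequently (Filter.Frequently.of_forall fun x => congrFun h3 x))
  exact Subtype.ext h5

/-- The identification of the entire Gaussian functions with `gaussianSpace`. -/
noncomputable def gaussEquiv : gaussFnSpace ≃ₗ[ℂ] gaussianSpace :=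
  LinearEquiv.ofBijective gaussIncl ⟨gaussIncl_injective, gaussIncl_surjective⟩

/-- The action of the generators on entire Gaussian functions. -/
noncomputable def genAction (b : ℝ) : Gen → Module.End ℂ gaussFnSpace
  | .e => weylEnd b 1 1 + weylEnd b (-1) 1
  | .f => weylEnd b 0 (-1)
  | .K => weylEnd b 1 0
  | .Kinv => weylEnd b (-1) 0

/-- `exp (2πbz)`, by which `K` multiplies. -/
noncomputable def expK (b : ℝ) (z : ℂ) : ℂ := Complex.exp (2 * Real.pi * b * z)

lemma expK_ne_zero (b : ℝ) (z : ℂ) : expK b z ≠ 0 := Complex.exp_ne_zero _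

lemma expK_sub (b : ℝ) (z : ℂ) : expK b (z - Complex.I * b) = (qParam b ^ 2)⁻¹ * expK b z := by
  rw [expK, expK, qParam, ← Complex.exp_nat_mul, ← Complex.exp_neg, ← Complex.exp_add]
  congr 1
  push_cast
  ring

lemma expK_add (b : ℝ) (z : ℂ) : expK b (z + Complex.I * b) = qParam b ^ 2 * expK b z := by
  rw [expK, expK, qParam, ← Complex.exp_nat_mul, ← Complex.exp_add]
  congr 1
  push_cast
  ring

lemma genAction_e (b : ℝ) (F : gaussFnSpace) (z : ℂ) :
    (genAction b .e F : ℂ → ℂ) z = ((qParam b)⁻¹ * expK b z + qParam b * (expK b z)⁻¹)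
      * (F : ℂ → ℂ) (z - Complex.I * b) := by
  change weylShift b 1 1 F z + weylShift b (-1) 1 F z = _
  rw [weylShift_apply, weylShift_apply, expK, qParam, ← Complex.exp_neg, ← Complex.exp_neg,
    ← Complex.exp_add, ← Complex.exp_add, add_mul, mul_one]
  congr 3 <;> (push_cast; ring)

lemma genAction_f (b : ℝ) (F : gaussFnSpace) (z : ℂ) :
    (genAction b .f F : ℂ → ℂ) z = (F : ℂ → ℂ) (z + Complex.I * b) := by
  change weylShift b 0 (-1) F z = _
  rw [weylShift_apply]
  simp

lemma genAction_K (b : ℝ) (F : gaussFnSpace) (z : ℂ) :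
    (genAction b .K F : ℂ → ℂ) z = expK b z * (F : ℂ → ℂ) z := by
  change weylShift b 1 0 F z = _
  rw [weylShift_apply]
  simp [expK]

lemma genAction_Kinv (b : ℝ) (F : gaussFnSpace) (z : ℂ) :
    (genAction b .Kinv F : ℂ → ℂ) z = (expK b z)⁻¹ * (F : ℂ → ℂ) z := by
  change weylShift b (-1) 0 F z = _
  rw [weylShift_apply]
  simp [expK, Complex.exp_neg]

lemma end_gaussFnSpace_ext {S T : Module.End ℂ gaussFnSpace}
    (h : ∀ (F : gaussFnSpace) (z : ℂ), (S F : ℂ → ℂ) z = (T F : ℂ → ℂ) z) : S = T :=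
  LinearMap.ext fun F => Subtype.ext (funext (h F))

lemma genAction_rel (b : ℝ) ⦃x y : FreeAlgebra ℂ Gen⦄ (h : Rel b x y) :
    FreeAlgebra.lift ℂ (genAction b) x = FreeAlgebra.lift ℂ (genAction b) y := by
  have hq := qParam_ne_zero b
  cases h with
  | K_Kinv =>
    simp only [map_mul, map_one, FreeAlgebra.lift_ι_apply]
    refine end_gaussFnSpace_ext fun F z => ?_
    rw [Module.End.mul_apply, genAction_K, genAction_Kinv, mul_inv_cancel_left₀ (expK_ne_zero b z),
      Module.End.one_apply]
  | Kinv_K =>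
    simp only [map_mul, map_one, FreeAlgebra.lift_ι_apply]
    refine end_gaussFnSpace_ext fun F z => ?_
    rw [Module.End.mul_apply, genAction_Kinv, genAction_K, inv_mul_cancel_left₀ (expK_ne_zero b z),
      Module.End.one_apply]
  | K_e =>
    simp only [map_mul, map_smul, FreeAlgebra.lift_ι_apply]
    refine end_gaussFnSpace_ext fun F z => ?_
    rw [Module.End.mul_apply, LinearMap.smul_apply, Module.End.mul_apply, Submodule.coe_smul,
      Pi.smul_apply, smul_eq_mul, genAction_K, genAction_e, genAction_e, genAction_K, expK_sub]
    field_simp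
  | K_f =>
    simp only [map_mul, map_smul, FreeAlgebra.lift_ι_apply]
    refine end_gaussFnSpace_ext fun F z => ?_
    rw [Module.End.mul_apply, LinearMap.smul_apply, Module.End.mul_apply, Submodule.coe_smul,
      Pi.smul_apply, smul_eq_mul, genAction_K, genAction_f, genAction_f, genAction_K, expK_add]
    field_simp
  | e_f =>
    simp only [map_mul, map_smul, map_sub, FreeAlgebra.lift_ι_apply]
    refine end_gaussFnSpace_ext fun F z => ?_
    have hK := expK_ne_zero b z
    rw [LinearMap.sub_apply, Module.End.mul_apply, Module.End.mul_apply, LinearMap.smul_apply,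
      LinearMap.sub_apply, Submodule.coe_smul, Submodule.coe_sub, Submodule.coe_sub,
      Pi.sub_apply, Pi.smul_apply, Pi.sub_apply, smul_eq_mul, genAction_e, genAction_f,
      genAction_f, genAction_e, genAction_K, genAction_Kinv, expK_add, sub_add_cancel,
      add_sub_cancel_right]
    field_simp
    ring

/-- The representation of `U_q(sl₂)` on entire Gaussian functions. -/
noncomputable def entireRep (b : ℝ) : Uq b →ₐ[ℂ] Module.End ℂ gaussFnSpace :=
  RingQuot.liftAlgHom ℂ ⟨FreeAlgebra.lift ℂ (genAction b), genAction_rel b⟩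

lemma entireRep_gen (b : ℝ) (g : Gen) : entireRep b (gen b g) = genAction b g := by
  rw [entireRep, gen, RingQuot.liftAlgHom_mkAlgHom_apply, FreeAlgebra.lift_ι_apply]

lemma entireRep_casimir (b : ℝ) : entireRep b (casimir b) = 0 := by
  have hq := qParam_ne_zero b
  rw [casimir, map_sub, map_sub, map_mul, map_smul, map_smul]
  simp only [entireRep_gen]
  refine end_gaussFnSpace_ext fun F z => ?_
  rw [LinearMap.sub_apply, LinearMap.sub_apply, Module.End.mul_apply, LinearMap.smul_apply,
    LinearMap.smul_apply, Submodule.coe_sub, Submodule.coe_sub, Submodule.coe_smul,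
    Submodule.coe_smul, Pi.sub_apply, Pi.sub_apply, Pi.smul_apply, Pi.smul_apply, smul_eq_mul,
    smul_eq_mul, genAction_e, genAction_f, genAction_K, genAction_Kinv, sub_add_cancel]
  change _ = 0
  ring

/-- The representation of `U_q(sl₂)` on `gaussianSpace`. -/
noncomputable def gaussRep (b : ℝ) : Uq b →ₐ[ℂ] Module.End ℂ gaussianSpace :=
  (gaussEquiv.conjAlgEquiv ℂ).toAlgHom.comp (entireRep b)

lemma gaussRep_gaussIncl (b : ℝ) (x : Uq b) (F : gaussFnSpace) :
    gaussRep b x (gaussIncl F) = gaussIncl (entireRep b x F) := by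
  change gaussEquiv (entireRep b x (gaussEquiv.symm (gaussEquiv F))) = _
  rw [LinearEquiv.symm_apply_apply]
  rfl

lemma mem_weylExp_graph_of_eq (b c β : ℝ) {α : ℝ} (h : β * c = α) (F : gaussFnSpace) :
    (gaussToL2 F, gaussToL2 (weylEnd b α β F)) ∈ (weylExp b c β).graph :=
  h ▸ mem_weylExp_graph b c β F

lemma mem_add_graph {H : Type} [NormedAddCommGroup H] [InnerProductSpace ℂ H]
    {A B : H →ₗ.[ℂ] H} {x y z : H} (hA : (x, y) ∈ A.graph) (hB : (x, z) ∈ B.graph) :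
    (x, y + z) ∈ (A + B).graph := by
  have h1 := LinearPMap.mem_domain_of_mem_graph hA
  have h2 := LinearPMap.mem_domain_of_mem_graph hB
  rw [LinearPMap.mem_graph_iff]
  refine ⟨⟨x, h1, h2⟩, rfl, ?_⟩
  rw [LinearPMap.add_apply]
  exact congrArg₂ _ ((LinearPMap.image_iff h1).mpr hA).symm ((LinearPMap.image_iff h2).mpr hB).symm

lemma gaussRep_e_graph (b : ℝ) (v : gaussianSpace) :
    ((v : L2R), (gaussRep b (gen b .e) v : L2R)) ∈ (weylExp b 1 1 + weylExp b (-1) 1).graph := by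
  obtain ⟨F, rfl⟩ := gaussIncl_surjective v
  rw [gaussRep_gaussIncl, entireRep_gen, coe_gaussIncl, coe_gaussIncl]
  change (_, gaussToL2 (weylEnd b 1 1 F + weylEnd b (-1) 1 F)) ∈ _
  rw [map_add]
  exact mem_add_graph (mem_weylExp_graph_of_eq b 1 1 (by norm_num) F)
    (mem_weylExp_graph_of_eq b (-1) 1 (by norm_num) F)

lemma gaussRep_f_graph (b : ℝ) (v : gaussianSpace) :
    ((v : L2R), (gaussRep b (gen b .f) v : L2R)) ∈ (weylExp b 0 (-1)).graph := by
  obtain ⟨F, rfl⟩ := gaussIncl_surjective v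
  rw [gaussRep_gaussIncl, entireRep_gen]
  exact mem_weylExp_graph_of_eq b 0 (-1) (by norm_num) F

lemma gaussRep_K_graph (b : ℝ) (v : gaussianSpace) :
    ((v : L2R), (gaussRep b (gen b .K) v : L2R)) ∈ (mulExp b 1).graph := by
  obtain ⟨F, rfl⟩ := gaussIncl_surjective v
  rw [gaussRep_gaussIncl, entireRep_gen]
  exact mem_mulExp_graph b 1 F

lemma gaussRep_Kinv_graph (b : ℝ) (v : gaussianSpace) :
    ((v : L2R), (gaussRep b (gen b .Kinv) v : L2R)) ∈ (mulExp b (-1)).graph := by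
  obtain ⟨F, rfl⟩ := gaussIncl_surjective v
  rw [gaussRep_gaussIncl, entireRep_gen]
  exact mem_mulExp_graph b (-1) F

lemma inner_eq_of_mem_graph {H : Type} [NormedAddCommGroup H] [InnerProductSpace ℂ H]
    {T : H →ₗ.[ℂ] H} (hT : ∀ x y : T.domain, ⟪T x, (y : H)⟫ = ⟪(x : H), T y⟫) {x x' y y' : H}
    (hx : (x, x') ∈ T.graph) (hy : (y, y') ∈ T.graph) : ⟪x', y⟫ = ⟪x, y'⟫ := by
  rw [LinearPMap.mem_graph_iff] at hx hy
  obtain ⟨x, rfl, rfl⟩ := hx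
  obtain ⟨y, rfl, rfl⟩ := hy
  exact hT x y

lemma weylExp_symm (b c β : ℝ) (x y : (weylExp b c β).domain) :
    ⟪weylExp b c β x, (y : L2R)⟫ = ⟪(x : L2R), weylExp b c β y⟫ :=
  diagOp_symm (W := chirpFourier c) (φ := fun ξ => Real.exp (2 * Real.pi * b * (β * ξ))) x y

lemma mulExp_symm (b α : ℝ) (x y : (mulExp b α).domain) :
    ⟪mulExp b α x, (y : L2R)⟫ = ⟪(x : L2R), mulExp b α y⟫ :=
  diagOp_symm (W := LinearIsometryEquiv.refl ℂ L2R)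
    (φ := fun x => Real.exp (2 * Real.pi * b * (α * x))) x y

lemma inner_gaussRep_gen (b : ℝ) (g : Gen) (v w : gaussianSpace) :
    ⟪(gaussRep b (gen b g) v : L2R), (w : L2R)⟫ = ⟪(v : L2R), (gaussRep b (gen b g) w : L2R)⟫ := by
  cases g with
  | e =>
    refine inner_eq_of_mem_graph (fun x y => ?_) (gaussRep_e_graph b v) (gaussRep_e_graph b w)
    rw [LinearPMap.add_apply, LinearPMap.add_apply, inner_add_left, inner_add_right]
    exact congrArg₂ _ (weylExp_symm b 1 1 ⟨x, x.2.1⟩ ⟨y, y.2.1⟩)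
      (weylExp_symm b (-1) 1 ⟨x, x.2.2⟩ ⟨y, y.2.2⟩)
  | f =>
    exact inner_eq_of_mem_graph (weylExp_symm b 0 (-1)) (gaussRep_f_graph b v)
      (gaussRep_f_graph b w)
  | K =>
    exact inner_eq_of_mem_graph (mulExp_symm b 1) (gaussRep_K_graph b v) (gaussRep_K_graph b w)
  | Kinv =>
    exact inner_eq_of_mem_graph (mulExp_symm b (-1)) (gaussRep_Kinv_graph b v)
      (gaussRep_Kinv_graph b w)

lemma inner_gaussRep (b : ℝ) (x : Uq b) (v w : gaussianSpace) :
    ⟪(gaussRep b x v : L2R), (w : L2R)⟫ = ⟪(v : L2R), (gaussRep b (star x) w : L2R)⟫ := by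
  obtain ⟨x, rfl⟩ := RingQuot.mkAlgHom_surjective ℂ (Rel b) x
  induction x using FreeAlgebra.induction generalizing v w with
  | grade0 c =>
    have h : star (algebraMap ℂ (Uq b) c) = algebraMap ℂ (Uq b) (starRingEnd ℂ c) := by
      rw [Algebra.algebraMap_eq_smul_one, star_smul, star_one, Algebra.algebraMap_eq_smul_one]
      rfl
    rw [AlgHom.commutes, h, AlgHom.commutes, AlgHom.commutes, Module.algebraMap_end_apply,
      Module.algebraMap_end_apply, Submodule.coe_smul, Submodule.coe_smul, inner_smul_left,
      inner_smul_right]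
  | grade1 g =>
    change ⟪(gaussRep b (gen b g) v : L2R), (w : L2R)⟫
      = ⟪(v : L2R), (gaussRep b (star (gen b g)) w : L2R)⟫
    rw [star_gen, inner_gaussRep_gen]
  | mul x y hx hy =>
    rw [map_mul, star_mul, map_mul, map_mul, Module.End.mul_apply, Module.End.mul_apply, hx, hy]
  | add x y hx hy =>
    rw [map_add, star_add, map_add, map_add, LinearMap.add_apply, LinearMap.add_apply,
      Submodule.coe_add, Submodule.coe_add, inner_add_left, inner_add_right, hx, hy]

/-! ### Irreducibility -/

/-- If `g ∘ φ` is unimodular, then `g` of the operator with spectral representation `W`, `φ` is a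
unitary operator. -/
lemma isBorelFun_unitary {H : Type} [NormedAddCommGroup H] [InnerProductSpace ℂ H] {X : Type}
    [MeasurableSpace X] {μ : Measure X} {W : H ≃ₗᵢ[ℂ] Lp ℂ 2 μ} {φ : X → ℝ} (hφ : Measurable φ)
    {g : ℝ → ℂ} {u : X → ℂ} (hu : Measurable u) (h1 : ∀ x, ‖u x‖ = 1) (hg : ∀ x, g (φ x) = u x)
    {V : H →L[ℂ] H} (hV : ∀ x, W (V x) = unimodMul u hu h1 (W x)) :
    IsBorelFun (diagOp W (fun a => (φ a : ℂ))) g ((V : H →ₗ[ℂ] H).toPMap ⊤) := by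
  have h : (V : H →ₗ[ℂ] H).toPMap ⊤ = diagOp W (fun a => g (φ a)) := by
    apply LinearPMap.eq_of_eq_graph
    ext ⟨x, y⟩
    have e : (fun a => u a * W x a) =ᵐ[μ] (W (V x) : X → ℂ) := by
      rw [hV]
      exact (coeFn_unimodMul u hu h1 (W x)).symm
    rw [mem_diagOp_graph, LinearPMap.mem_graph_iff]
    simp only [hg]
    constructor
    · rintro ⟨z, rfl, rfl⟩
      exact e.symm
    · intro hy
      refine ⟨⟨x, trivial⟩, rfl, W.injective (Lp.ext ?_)⟩
      exact e.symm.trans hy.symm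
  rw [h]
  exact isBorelFun_diagOp W hφ g

lemma exp_cpow_I_mul (r t : ℝ) :
    (Real.exp r : ℂ) ^ (Complex.I * (t : ℂ)) = Complex.exp (Complex.I * (t * r : ℝ)) := by
  rw [Complex.ofReal_exp, Complex.cpow_def_of_ne_zero (Complex.exp_ne_zero _), ← Complex.ofReal_exp,
    ← Complex.ofReal_log (Real.exp_pos r).le, Real.log_exp]
  congr 1
  push_cast
  ring

/-- The modulation `exp (isx)`. -/
noncomputable def modulation (s : ℝ) : L2R ≃ₗᵢ[ℂ] L2R :=
  unimodMul (fun x : ℝ => Complex.exp (Complex.I * (s * x : ℝ)))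
    (by fun_prop) (fun x => by rw [mul_comm, Complex.norm_exp_ofReal_mul_I])

lemma coeFn_modulation (s : ℝ) (f : L2R) : (modulation s f : ℝ → ℂ) =ᵐ[volume]
    fun x : ℝ => Complex.exp (Complex.I * s * x) * f x := by
  filter_upwards [coeFn_unimodMul (fun x : ℝ => Complex.exp (Complex.I * (s * x : ℝ)))
    (by fun_prop) (fun x => by rw [mul_comm, Complex.norm_exp_ofReal_mul_I]) f] with x hx
  rw [modulation, hx]
  push_cast
  rw [mul_assoc]

/-- The translation `f ↦ f (· - s)`. -/
noncomputable def translation (s : ℝ) : L2R →ₗᵢ[ℂ] L2R :=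
  Lp.compMeasurePreservingₗᵢ ℂ (fun x : ℝ => x - s) (measurePreserving_sub_right volume s)

lemma coeFn_translation (s : ℝ) (f : L2R) : (translation s f : ℝ → ℂ) =ᵐ[volume]
    fun x : ℝ => f (x - s) :=
  Lp.coeFn_compMeasurePreserving f (measurePreserving_sub_right volume s)

lemma translation_schwartzIncl (s : ℝ) (ψ : 𝓢(ℝ, ℂ)) :
    translation s (schwartzIncl ψ) = schwartzIncl (ψ.compSubConstCLM ℂ s) := by
  apply Lp.ext
  have h := (measurePreserving_sub_right volume s).quasiMeasurePreserving.ae (coeFn_schwartzIncl ψ)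
  filter_upwards [coeFn_translation s (schwartzIncl ψ),
    coeFn_schwartzIncl (ψ.compSubConstCLM ℂ s), h] with x h1 h2 h3
  rw [h1, h2, h3, SchwartzMap.compSubConstCLM_apply]

lemma fourier_compSubConst (s : ℝ) (ψ : 𝓢(ℝ, ℂ)) (ξ : ℝ) :
    𝓕 (ψ.compSubConstCLM ℂ s) ξ = Complex.exp (Complex.I * (-2 * Real.pi * s) * ξ) * 𝓕 ψ ξ := by
  rw [SchwartzMap.fourier_coe, SchwartzMap.fourier_coe, Real.fourier_real_eq_integral_exp_smul,
    Real.fourier_real_eq_integral_exp_smul, ← integral_const_mul,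
    ← integral_add_right_eq_self (μ := volume) _ s]
  congr 1
  funext x
  rw [SchwartzMap.compSubConstCLM_apply, add_sub_cancel_right, smul_eq_mul, smul_eq_mul,
    ← mul_assoc, ← Complex.exp_add]
  congr 2
  push_cast
  ring

/-- For `c = 0` the chirp is trivial, and the Fourier transform turns translations into
modulations. -/
lemma chirpFourier_translation (s : ℝ) (f : L2R) :
    chirpFourier 0 (translation s f) = modulation (-2 * Real.pi * s) (chirpFourier 0 f) := by
  -- both sides are continuous in `f`, so that it suffices to compare them on Schwartz functions
  have hd : DenseRange schwartzIncl :=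
    SchwartzMap.denseRange_toLpCLM (E := ℝ) (F := ℂ) (p := 2) (μ := volume) (by norm_num)
  have hF : ∀ ψ, chirpFourier 0 (schwartzIncl ψ) = schwartzIncl (𝓕 ψ) := by
    intro ψ
    apply chirpFourier_eq
    filter_upwards [coeFn_schwartzIncl ψ] with x hx
    rw [hx, chirp_eq]
    simp
  refine congrFun (hd.equalizer (g := fun f => chirpFourier 0 (translation s f))
    (h := fun f => modulation (-2 * Real.pi * s) (chirpFourier 0 f)) ?_ ?_ ?_) f
  · exact (chirpFourier 0).continuous.comp (translation s).continuous
  · exact (modulation _).continuous.comp (chirpFourier 0).continuous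
  · funext ψ
    simp only [Function.comp_apply]
    rw [translation_schwartzIncl, hF, hF]
    apply Lp.ext
    filter_upwards [coeFn_schwartzIncl (𝓕 (ψ.compSubConstCLM ℂ s)), coeFn_schwartzIncl (𝓕 ψ),
      coeFn_modulation (-2 * Real.pi * s) (schwartzIncl (𝓕 ψ))] with ξ h1 h2 h3
    rw [h1, h3, h2, fourier_compSubConst]
    push_cast
    rfl

lemma comm_modulation_of_stronglyCommutes {b : ℝ} (hb : 0 < b) {X : L2R →L[ℂ] L2R}
    (hX : StronglyCommutes X (mulExp b 1)) (s : ℝ) (f : L2R) :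
    X (modulation s f) = modulation s (X f) := by
  have hpb : 2 * Real.pi * b ≠ 0 := by positivity
  -- `K^{it}` is multiplication by `exp (2πibtx)`
  have h := hX (s / (2 * Real.pi * b)) ((modulation s).toContinuousLinearEquiv : L2R →L[ℂ] L2R)
    (isBorelFun_unitary (W := LinearIsometryEquiv.refl ℂ L2R)
      (φ := fun x => Real.exp (2 * Real.pi * b * (1 * x)))
      (u := fun x : ℝ => Complex.exp (Complex.I * (s * x : ℝ))) (by fun_prop) (by fun_prop)
      (fun x => by rw [mul_comm, Complex.norm_exp_ofReal_mul_I]) (fun x => by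
        rw [exp_cpow_I_mul]
        congr 3
        field_simp) (fun f => rfl))
  exact DFunLike.congr_fun h f

lemma comm_translation_of_stronglyCommutes {b : ℝ} (hb : 0 < b) {X : L2R →L[ℂ] L2R}
    (hX : StronglyCommutes X (weylExp b 0 (-1))) (s : ℝ) (f : L2R) :
    X (translation s f) = translation s (X f) := by
  have hpb : 2 * Real.pi * b ≠ 0 := by positivity
  -- in the Fourier representation, `f^{it}` is multiplication by `exp (-2πibtξ)`
  have h := hX (s / b) (translation s).toContinuousLinearMap
    (isBorelFun_unitary (W := chirpFourier 0)
      (φ := fun x => Real.exp (2 * Real.pi * b * (-1 * x)))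
      (u := fun x : ℝ => Complex.exp (Complex.I * ((-2 * Real.pi * s) * x : ℝ)))
      (by fun_prop) (by fun_prop)
      (fun x => by rw [mul_comm, Complex.norm_exp_ofReal_mul_I]) (fun x => by
        rw [exp_cpow_I_mul]
        congr 3
        field_simp) (chirpFourier_translation s))
  exact DFunLike.congr_fun h f

/-- For an operator `X` that commutes with modulations, the integrable functions `conj (X* h) f`
and `conj h (X f)` have the same Fourier transform. -/
lemma ae_eq_of_comm_modulation {X : L2R →L[ℂ] L2R}
    (hX : ∀ s f, X (modulation s f) = modulation s (X f)) (f h : L2R) :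
    (fun x => starRingEnd ℂ (X.adjoint h x) * f x) =ᵐ[volume]
      fun x => starRingEnd ℂ (h x) * X f x := by
  have hi : ∀ f h : L2R, Integrable (fun x => starRingEnd ℂ (h x) * f x) := fun f h => by
    simpa only [RCLike.inner_apply, mul_comm] using L2.integrable_inner (𝕜 := ℂ) h f
  have hm : ∀ (s : ℝ) (f h : L2R),
      ∫ x : ℝ, Complex.exp (Complex.I * s * x) * (starRingEnd ℂ (h x) * f x)
        = ⟪h, modulation s f⟫ := by
    intro s f h
    rw [inner_eq_integral (LinearIsometryEquiv.refl ℂ L2R)]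
    apply integral_congr_ae
    filter_upwards [coeFn_modulation s f] with x hx
    simp only [LinearIsometryEquiv.coe_refl, id_eq]
    rw [hx]
    ring
  have hie : ∀ (s : ℝ) (f h : L2R), Integrable
      (fun x : ℝ => Complex.exp (Complex.I * s * x) * (starRingEnd ℂ (h x) * f x)) := by
    intro s f h
    refine (hi (modulation s f) h).congr ?_
    filter_upwards [coeFn_modulation s f] with x hx
    rw [hx]
    ring
  have key := ae_eq_zero_of_integral_exp_mul_eq_zero
    ((hi f (X.adjoint h)).sub (hi (X f) h)) (fun s => by
      simp only [Pi.sub_apply, mul_sub]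
      rw [integral_sub (hie s _ _) (hie s _ _), hm, hm, ContinuousLinearMap.adjoint_inner_left, hX,
        sub_self])
  filter_upwards [key] with x hx
  exact sub_eq_zero.mp hx

/-- A measurable function invariant under all translations is constant almost everywhere. -/
lemma exists_ae_eq_const_of_translation {m : ℝ → ℂ} (hm : Measurable m)
    (h : ∀ s : ℝ, ∀ᵐ x : ℝ, m x = m (x - s)) : ∃ c : ℂ, ∀ᵐ x : ℝ, m x = c := by
  have hms : MeasurableSet {p : ℝ × ℝ | m p.2 = m (p.2 - p.1)} :=
    measurableSet_eq_fun (hm.comp measurable_snd)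
      (hm.comp (measurable_snd.sub measurable_fst))
  have h2 : ∀ᵐ x : ℝ, ∀ᵐ s : ℝ, m x = m (x - s) :=
    (Measure.ae_ae_comm (μ := volume) (ν := volume) (p := fun s x : ℝ => m x = m (x - s)) hms).mp
      (Filter.Eventually.of_forall h)
  obtain ⟨x, hx⟩ := h2.exists
  refine ⟨m x, ?_⟩
  filter_upwards [(Measure.measurePreserving_sub_left volume x).quasiMeasurePreserving.ae hx]
    with y hy
  rw [hy, sub_sub_cancel]

/-- The Schrödinger representation is irreducible: an operator that commutes with modulations is
multiplication by a function, which is constant if the operator commutes with translations. -/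
lemma eq_smul_id_of_comm {X : L2R →L[ℂ] L2R}
    (hmod : ∀ s f, X (modulation s f) = modulation s (X f))
    (htr : ∀ s f, X (translation s f) = translation s (X f)) :
    ∃ c : ℂ, X = c • ContinuousLinearMap.id ℂ L2R := by
  set g := modulatedGaussian 0 with hg
  set γ : ℝ → ℂ := fun x => Complex.exp (-(x : ℂ) ^ 2) with hγ
  have hγ0 : ∀ x, γ x ≠ 0 := fun x => Complex.exp_ne_zero _
  have hgγ : (g : ℝ → ℂ) =ᵐ[volume] γ := by
    filter_upwards [coeFn_modulatedGaussian 0] with x hx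
    rw [hg, hx]
    simp [hγ]
  set m : ℝ → ℂ := fun x => starRingEnd ℂ (X.adjoint g x) / starRingEnd ℂ (γ x) with hm
  have hmeas : Measurable m := by
    have h1 : Measurable (X.adjoint g : ℝ → ℂ) := (Lp.stronglyMeasurable _).measurable
    have h2 : Measurable γ := by fun_prop
    exact (Complex.continuous_conj.measurable.comp h1).div
      (Complex.continuous_conj.measurable.comp h2)
  have hXm : ∀ f : L2R, (X f : ℝ → ℂ) =ᵐ[volume] fun x => m x * f x := by
    intro f
    filter_upwards [ae_eq_of_comm_modulation hmod f g, hgγ] with x h1 h2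
    rw [h2] at h1
    have h3 : starRingEnd ℂ (γ x) ≠ 0 := by simpa using hγ0 x
    rw [hm]
    field_simp
    rw [h1, mul_comm]
  obtain ⟨c, hc⟩ := exists_ae_eq_const_of_translation hmeas (fun s => by
    have q := (measurePreserving_sub_right volume s).quasiMeasurePreserving
    have h1 := coeFn_translation s (X g)
    rw [← htr] at h1
    filter_upwards [h1, hXm (translation s g), coeFn_translation s g, q.ae hgγ, q.ae (hXm g)]
      with x e1 e2 e3 e4 e5
    rw [e2, e3, e5, e4] at e1
    exact mul_right_cancel₀ (hγ0 _) e1)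
  refine ⟨c, ContinuousLinearMap.ext fun f => Lp.ext ?_⟩
  filter_upwards [hXm f, hc, Lp.coeFn_smul c f] with x h1 h2 h3
  rw [h1, h2]
  exact h3.symm

end QuantumSL2

theorem mainTheorem11 (b : ℝ) (hb0 : 0 < b) (hb1 : b < 1) (hb : Irrational (b ^ 2)) :
    ∃ (E₁ E₂ e f K : QuantumSL2.L2R →ₗ.[ℂ] QuantumSL2.L2R)
      (π : QuantumSL2.Uq b →ₐ[ℂ] Module.End ℂ QuantumSL2.gaussianSpace),
      -- the operators are given by the asserted formulas
      QuantumSL2.IsWeylExp b 1 1 E₁ ∧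
      QuantumSL2.IsWeylExp b (-1) 1 E₂ ∧
      QuantumSL2.IsFormSum E₁ E₂ e ∧ E₁ + E₂ ≤ e ∧
      QuantumSL2.IsWeylExp b 0 (-1) f ∧
      QuantumSL2.IsWeylExp b 1 0 K ∧
      -- they are positive self-adjoint
      QuantumSL2.IsPositiveSelfAdjoint e ∧
      QuantumSL2.IsPositiveSelfAdjoint f ∧
      QuantumSL2.IsPositiveSelfAdjoint K ∧
      -- the dense domain of the representation, a core of the exponentials
      Dense (QuantumSL2.gaussianSpace : Set QuantumSL2.L2R) ∧
      E₁.HasCore QuantumSL2.gaussianSpace ∧ E₂.HasCore QuantumSL2.gaussianSpace ∧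
      f.HasCore QuantumSL2.gaussianSpace ∧ K.HasCore QuantumSL2.gaussianSpace ∧
      -- the generators act by these operators
      (∀ v : QuantumSL2.gaussianSpace,
        ((v : QuantumSL2.L2R), (π (QuantumSL2.gen b .e) v : QuantumSL2.L2R)) ∈ (E₁ + E₂).graph ∧
        ((v : QuantumSL2.L2R), (π (QuantumSL2.gen b .f) v : QuantumSL2.L2R)) ∈ f.graph ∧
        ((v : QuantumSL2.L2R), (π (QuantumSL2.gen b .K) v : QuantumSL2.L2R)) ∈ K.graph) ∧
      -- the representation respects the star structure
      (∀ (x : QuantumSL2.Uq b) (v w : QuantumSL2.gaussianSpace),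
        inner ℂ (π x v : QuantumSL2.L2R) (w : QuantumSL2.L2R)
          = inner ℂ (v : QuantumSL2.L2R) (π (star x) w : QuantumSL2.L2R)) ∧
      -- the Casimir acts by zero
      π (QuantumSL2.casimir b) = 0 ∧
      -- irreducibility
      (∀ X : QuantumSL2.L2R →L[ℂ] QuantumSL2.L2R,
        QuantumSL2.StronglyCommutes X e → QuantumSL2.StronglyCommutes X f →
        QuantumSL2.StronglyCommutes X K →
        ∃ c : ℂ, X = c • ContinuousLinearMap.id ℂ QuantumSL2.L2R) := by
  -- the two summands of `e` are both defined on the dense subspace of Gaussian functions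
  have hdense : Dense (((QuantumSL2.weylExp b 1 1).domain ⊓
      (QuantumSL2.weylExp b (-1) 1).domain : Submodule ℂ QuantumSL2.L2R) : Set QuantumSL2.L2R) :=
    QuantumSL2.dense_gaussianSpace.mono (le_inf (QuantumSL2.hasCore_weylExp b 1 1).le_domain
      (QuantumSL2.hasCore_weylExp b (-1) 1).le_domain)
  obtain ⟨e, hsum, hle, hpos⟩ := QuantumSL2.exists_formSum_diagOp
    (W := QuantumSL2.chirpFourier 1) (V := QuantumSL2.chirpFourier (-1))
    (φ := fun ξ => Real.exp (2 * Real.pi * b * (1 * ξ)))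
    (ψ := fun ξ => Real.exp (2 * Real.pi * b * (1 * ξ)))
    (by fun_prop) (by fun_prop) (fun _ => Real.exp_pos _) (fun _ => Real.exp_pos _) hdense
  refine ⟨QuantumSL2.weylExp b 1 1, QuantumSL2.weylExp b (-1) 1, e, QuantumSL2.weylExp b 0 (-1),
    QuantumSL2.mulExp b 1, QuantumSL2.gaussRep b, ?_, ?_, hsum, hle, ?_,
    QuantumSL2.isWeylExp_mulExp b 1, hpos, ?_, ?_, QuantumSL2.dense_gaussianSpace,
    QuantumSL2.hasCore_weylExp b 1 1, QuantumSL2.hasCore_weylExp b (-1) 1,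
    QuantumSL2.hasCore_weylExp b 0 (-1), QuantumSL2.hasCore_mulExp b 1,
    fun v => ⟨QuantumSL2.gaussRep_e_graph b v, QuantumSL2.gaussRep_f_graph b v,
      QuantumSL2.gaussRep_K_graph b v⟩,
    QuantumSL2.inner_gaussRep b, ?_, fun X _ hf hK => ?_⟩
  · simpa using QuantumSL2.isWeylExp_weylExp b 1 1
  · simpa using QuantumSL2.isWeylExp_weylExp b (-1) 1
  · simpa using QuantumSL2.isWeylExp_weylExp b 0 (-1)
  · exact QuantumSL2.isPositiveSelfAdjoint_diagOp (by fun_prop) fun _ => Real.exp_pos _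
  · exact QuantumSL2.isPositiveSelfAdjoint_diagOp (by fun_prop) fun _ => Real.exp_pos _
  · rw [QuantumSL2.gaussRep, AlgHom.comp_apply, QuantumSL2.entireRep_casimir, map_zero]
  · exact QuantumSL2.eq_smul_id_of_comm
      (QuantumSL2.comm_modulation_of_stronglyCommutes hb0 hK)
      (QuantumSL2.comm_translation_of_stronglyCommutes hb0 hf)
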